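/- **Definitions.** Let $\Gamma$ be a finite alphabet and $\#\notin\Gamma$ a padding symbol. The convolution of strings $w_1,\dots,w_k\in\Gamma^*$ is the string of columns obtained by writing $w_1,\dots,w_k$ one below the other and padding the shorter ones at the end with $\#$ up to the length of the longest. A relation on strings is *automatic* if the set of convolutions of its tuples is a regular language. A (possibly partial) function $f$ from $k$-tuples of strings to strings is *automatic* if its graph $\{(x_1,\dots,x_k,y) : x\in\mathrm{dom}(f),\ y=f(x)\}$ is automatic; a truth-valued operation is automatic if the relation on which it is true is automatic. A *deterministic automatic register machine* (DARM) with finite input alphabet $\Sigma$ has a finite machine alphabet $\Gamma\supseteq\Sigma$, finitely many registers, each holding a string over $\Gamma$ and initially empty, a finite set of automatic functions and automatic truth-valued operations, and a program, that is, a finite list of numbered instructions of the following forms: read the input string into a register; write (output) the content of a register; assign a fixed string over $\Sigma$ to a register; copy a register; assign to a register the result of one of the automatic functions applied to registers; goto a line; goto a line if one of the automatic truth-valued operations holds of given registers; halt; halt and accept; halt and reject. The program starts at its first line and runs sequentially except for jumps; performing one instruction counts as one step. For $f:\mathbb N\to\mathbb R$, $\mathrm{DAL}[f(n)]$ is the class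 of languages $L\subseteq\Sigma^*$ for which there are a DARM $M$ and a function $t:\mathbb N\to\mathbb N$ with $t(n)=O(f(n))$ such that, on every input $w\in\Sigma^*$, $M$ halts within $t(|w|)$ steps, accepting if $w\in L$ and rejecting if $w\notin L$. Let $\mathrm{DAL}[\mathrm{poly}(n)]=\bigcup_{k\ge 0}\mathrm{DAL}[n^k]$, and let $\mathrm P$ be the class of languages decided by deterministic single-tape Turing machines in $O(n^k)$ steps for some $k$. **Theorem.** For every finite alphabet $\Sigma$, the languages over $\Sigma$ satisfy $$\mathrm{DAL}[\mathrm{poly}(n)]=\mathrm P .$$ -/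

import Mathlib

open Filter Asymptotics

/-! ### Convolutions, automatic relations and automatic functions -/

/-- The convolution of a finite family of strings: its letters are the columns of the strings
written one below the other, the shorter strings being padded at their end. The padding symbol
`#` is `none`, and the number of columns is the length of the longest string. -/
def conv {ι Γ : Type} [Fintype ι] (w : ι → List Γ) : List (ι → Option Γ) :=
  List.ofFn (n := Finset.univ.sup fun j => (w j).length) fun i j => (w j)[(i : ℕ)]?

/-- The language of all convolutions of the tuples in a relation on strings. -/
def convLanguage {ι Γ : Type} [Fintype ι] (S : Set (ι → List Γ)) : Language (ι → Option Γ) :=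
  conv '' S

/-- A relation on strings is automatic iff the set of the convolutions of its tuples
is regular. -/
def IsAutomaticRel {ι Γ : Type} [Fintype ι] (S : Set (ι → List Γ)) : Prop :=
  (convLanguage S).IsRegular

/-- The graph `{(x₁, …, x_k, y) | x ∈ domain f, y = f x}` of a partial function on `k` strings;
`f x = none` means that `x` is not in the domain of `f`. -/
def fnGraph {Γ : Type} {k : ℕ} (f : (Fin k → List Γ) → Option (List Γ)) :
    Set (Fin (k + 1) → List Γ) :=
  {v | f (fun i => v i.castSucc) = some (v (Fin.last k))}

/-- A (partial) function on strings is automatic iff its graph is an automatic relation. -/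
def IsAutomaticFn {Γ : Type} {k : ℕ} (f : (Fin k → List Γ) → Option (List Γ)) : Prop :=
  IsAutomaticRel (fnGraph f)

/-! ### Deterministic automatic register machines -/

/-- Instructions of a register machine with input alphabet `A` and `r` registers. The string-valued
operations are named by `F`, with arities `fa`, and the truth-valued ones by `T`, with
arities `ta`. Line numbers are the positions in the program, starting with `0`. -/
inductive ARMInstr (A F T : Type) (fa : F → ℕ) (ta : T → ℕ) (r : ℕ) : Type
  | read (i : Fin r)
  | write (i : Fin r)
  | assign (i : Fin r) (w : List A)
  | copy (i j : Fin r)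
  | apply (i : Fin r) (f : F) (args : Fin (fa f) → Fin r)
  | goto (l : ℕ)
  | ifGoto (p : T) (args : Fin (ta p) → Fin r) (l : ℕ)
  | halt
  | haltAccept
  | haltReject

/-- A deterministic automatic register machine with input alphabet `A`. The set `Op` of operations
consists of the finitely many automatic functions `fn f` and of the finitely many automatic
truth-valued operations `test p`; the latter are the conditions of conditional jumps. -/
structure DARM (A : Type) where
  /-- machine alphabet -/
  Γ : Type
  finΓ : Finite Γ
  /-- the input alphabet is a part of the machine alphabet -/
  incl : A ↪ Γ
  /-- number of registers -/
  r : ℕ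
  /-- names of the string-valued operations -/
  F : Type
  finF : Finite F
  fa : F → ℕ
  fn : (f : F) → (Fin (fa f) → List Γ) → Option (List Γ)
  fn_automatic : ∀ f, IsAutomaticFn (fn f)
  /-- names of the truth-valued operations -/
  T : Type
  finT : Finite T
  ta : T → ℕ
  test : (p : T) → Set (Fin (ta p) → List Γ)
  test_automatic : ∀ p, IsAutomaticRel (test p)
  prog : List (ARMInstr A F T fa ta r)

/-- Control status: about to perform a line, or halted in one of the three ways. -/
inductive ARMStatus : Type
  | line (l : ℕ)
  | halted
  | accepted
  | rejected

namespace DARM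

variable {A : Type}

/-- Configurations of a machine: control status, register contents, and strings written so far. -/
structure Config (M : DARM A) where
  status : ARMStatus
  regs : Fin M.r → List M.Γ
  output : List (List M.Γ)

/-- All registers are initially empty and the program starts at its first line. -/
def init (M : DARM A) : M.Config where
  status := .line 0
  regs := fun _ => []
  output := []

open Classical in
/-- The effect of performing one instruction, located at line `l`, on input `w`. Applying an
operation outside of its domain has no result: the machine then stays where it is forever
and never halts. -/
noncomputable def exec (M : DARM A) (w : List A) (c : M.Config) (l : ℕ) :
    ARMInstr A M.F M.T M.fa M.ta M.r → M.Config
  | .read i => ⟨.line (l + 1), Function.update c.regs i (w.map M.incl), c.output⟩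
  | .write i => ⟨.line (l + 1), c.regs, c.output ++ [c.regs i]⟩
  | .assign i u => ⟨.line (l + 1), Function.update c.regs i (u.map M.incl), c.output⟩
  | .copy i j => ⟨.line (l + 1), Function.update c.regs i (c.regs j), c.output⟩
  | .apply i f args =>
      match M.fn f (fun j => c.regs (args j)) with
      | some y => ⟨.line (l + 1), Function.update c.regs i y, c.output⟩
      | none => c
  | .goto l' => ⟨.line l', c.regs, c.output⟩
  | .ifGoto p args l' =>
      if (fun j => c.regs (args j)) ∈ M.test p then ⟨.line l', c.regs, c.output⟩
      else ⟨.line (l + 1), c.regs, c.output⟩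
  | .halt => ⟨.halted, c.regs, c.output⟩
  | .haltAccept => ⟨.accepted, c.regs, c.output⟩
  | .haltReject => ⟨.rejected, c.regs, c.output⟩

/-- One step performs one line of the program. A halted machine does not change any more, and
neither does one whose current line does not exist. -/
noncomputable def step (M : DARM A) (w : List A) (c : M.Config) : M.Config :=
  match c.status with
  | .line l =>
      match M.prog[l]? with
      | some I => M.exec w c l I
      | none => c
  | _ => c

/-- The configuration after `m` steps on input `w`. -/
noncomputable def run (M : DARM A) (w : List A) (m : ℕ) : M.Config :=
  (M.step w)^[m] M.init

/-- `M` recognizes `L` within `t n` steps on inputs of length `n`: members of `L` are accepted and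
all other strings are rejected, in both cases within the time bound. -/
def RecognizesIn (M : DARM A) (L : Language A) (t : ℕ → ℕ) : Prop :=
  ∀ w : List A,
    (w ∈ L → ∃ m ≤ t w.length, (M.run w m).status = .accepted) ∧
    (w ∉ L → ∃ m ≤ t w.length, (M.run w m).status = .rejected)

end DARM

/-- `DAL f`: the languages over `A` that are recognized by a deterministic automatic register
machine in `O(f(n))` steps. -/
def DAL (A : Type) (f : ℕ → ℝ) : Set (Language A) :=
  {L | ∃ (M : DARM A) (t : ℕ → ℕ), (fun n => (t n : ℝ)) =O[atTop] f ∧ M.RecognizesIn L t}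

/-- `DAL[poly(n)]`. -/
def DALPoly (A : Type) : Set (Language A) :=
  ⋃ k : ℕ, DAL A fun n => (n : ℝ) ^ k

/-! ### Deterministic single-tape Turing machines and polynomial time -/

/-- Head moves: left, right, stay. -/
inductive HeadMove : Type
  | L
  | R
  | S

/-- A deterministic Turing machine with one tape, infinite to the right, and input
alphabet `A`. -/
structure DTM (A : Type) where
  /-- tape alphabet -/
  Γ : Type
  finΓ : Finite Γ
  /-- the input alphabet is a part of the tape alphabet -/
  incl : A ↪ Γ
  blank : Γ
  incl_ne_blank : ∀ a, incl a ≠ blank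
  /-- states -/
  Q : Type
  finQ : Finite Q
  qStart : Q
  qAccept : Q
  qReject : Q
  accept_ne_reject : qAccept ≠ qReject
  δ : Q → Γ → Q × Γ × HeadMove

namespace DTM

variable {A : Type}

/-- Configurations: state, head position (the leftmost cell is cell `0`), tape content. -/
structure Config (M : DTM A) where
  state : M.Q
  head : ℕ
  tape : ℕ → M.Γ

/-- The input is written on the leftmost cells, all other cells are blank, and the head is on
the leftmost cell. -/
def init (M : DTM A) (w : List A) : M.Config where
  state := M.qStart
  head := 0
  tape := fun i => (w.map M.incl).getD i M.blank

/-- New head position; a head on the leftmost cell that is told to move left stays there. -/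
def moveHead (h : ℕ) : HeadMove → ℕ
  | .L => h - 1
  | .R => h + 1
  | .S => h

open Classical in
/-- One step; a machine in one of its two halting states does not change any more. -/
noncomputable def step (M : DTM A) (c : M.Config) : M.Config :=
  if c.state = M.qAccept ∨ c.state = M.qReject then c
  else
    let d := M.δ c.state (c.tape c.head)
    ⟨d.1, moveHead c.head d.2.2, Function.update c.tape c.head d.2.1⟩

/-- The configuration after `m` steps on input `w`. -/
noncomputable def run (M : DTM A) (w : List A) (m : ℕ) : M.Config :=
  M.step^[m] (M.init w)

/-- `M` decides `L` within `t n` steps on inputs of length `n`. -/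
def DecidesIn (M : DTM A) (L : Language A) (t : ℕ → ℕ) : Prop :=
  ∀ w : List A,
    (w ∈ L → ∃ m ≤ t w.length, (M.run w m).state = M.qAccept) ∧
    (w ∉ L → ∃ m ≤ t w.length, (M.run w m).state = M.qReject)

end DTM

/-- `DTIME f`: the languages over `A` decided by a deterministic Turing machine in `O(f(n))`
steps. -/
def DTIME (A : Type) (f : ℕ → ℝ) : Set (Language A) :=
  {L | ∃ (M : DTM A) (t : ℕ → ℕ), (fun n => (t n : ℝ)) =O[atTop] f ∧ M.DecidesIn L t}

/-- The class `P`. -/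
def PTIME (A : Type) : Set (Language A) :=
  ⋃ k : ℕ, DTIME A fun n => (n : ℝ) ^ k

/-! Write the tape of a Turing machine as a string of cells, the scanned cell also carrying the
state. After a step, each cell is determined by the old contents of itself and its two neighbours.
Such a window condition on the columns of a convolution is checked by a finite automaton
(`isAutomaticRel_of_local`), so the step is an automatic function (`DTM.localMap_stepRule`). A
register machine repeats it, with four instructions per Turing step (`DTM.darm_simulates`).

Conversely, the input and the registers become tracks of one tape. To compute `y = f x`, an
automaton for the graph of `f` reads the columns together with guessed letters of `y`. A forward
sweep determinizes the guessing: it leaves in each cell the set of states reachable there and turns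
at a blank column where this set contains an accepting state. A backward sweep follows one accepting
run through the stored sets and writes down its guesses (`Sweeper.sweep_back`). As an accepted guess
must be the padded `y`, the choice of the run does not matter (`Sweeper.simulates_store`).

Beyond the longest register all columns are blank, and the sets of states are iterates of one fixed
map on a finite type. If acceptance happens at all, it happens within a constant number `K` of cells
(`exists_iterate_mem_of_card`). Each instruction thus lengthens the contents by at most `K`, and `t`
instructions on an input of length `n` cost of the order of `t * (n + 1 + t * K)` Turing steps,
which is polynomial if `t` is. -/

/-! ### Regular languages given by local conditions -/

/-- The predecessor of the `i`-th term of a sequence, if there is one. -/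
def prevTerm {β : Type} (s : ℕ → β) : ℕ → Option β
  | 0 => none
  | i + 1 => some (s i)

/-- The strings all of whose windows of three consecutive positions satisfy `P`. The windows range
over all positions, also those after the end of the string. -/
def localLanguage {α : Type} (P : Option (Option α) → Option α → Option α → Prop) : Language α :=
  {l | ∀ i, P (prevTerm (fun i => l[i]?) i) l[i]? l[i + 1]?}

open Classical in
/-- An automaton for `localLanguage P`; it remembers the last two positions. -/
noncomputable def localDFA {α : Type} (P : Option (Option α) → Option α → Option α → Prop) :
    DFA α (Option (Option (Option α) × Option (Option α))) where
  step s a := s.bind fun s =>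
    if ∀ c, s.2 = some c → P s.1 c (some a) then some (s.2, some (some a)) else none
  start := some (none, none)
  -- Three windows are still unchecked at the end: at the last letter, at the first position after
  -- it, and the one common to all later positions.
  accept := {s | ∃ p q, s = some (p, q) ∧ (∀ c, q = some c → P p c none) ∧ P q none none ∧
    P (some none) none none}

theorem localDFA_evalFrom_none {α : Type} (P : Option (Option α) → Option α → Option α → Prop)
    (l : List α) : (localDFA P).evalFrom none l = none := by
  induction l with
  | nil => rfl
  | cons a l ih => exact ih

/-- The induction needs an arbitrary live state. Here `q` is the position just read, whose window is
pending because its right neighbour is still unknown, and `p` is the position before it. -/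
theorem localDFA_evalFrom {α : Type} (P : Option (Option α) → Option α → Option α → Prop)
    (l : List α) (p q : Option (Option α)) :
    (localDFA P).evalFrom (some (p, q)) l ∈ (localDFA P).accept ↔
      (∀ c, q = some c → P p c l[0]?) ∧
        ∀ i, P (if i = 0 then q else prevTerm (fun i => l[i]?) i) l[i]? l[i + 1]? := by
  induction l generalizing p q with
  | nil =>
    constructor
    · rintro ⟨p', q', h, h1, h2, h3⟩
      cases h
      refine ⟨by simpa using h1, ?_⟩
      rintro (_ | i)
      · simpa using h2
      · simpa [prevTerm] using h3
    · rintro ⟨h1, h2⟩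
      exact ⟨p, q, rfl, by simpa using h1, by simpa using h2 0, by simpa [prevTerm] using h2 1⟩
  | cons a l ih =>
    rw [DFA.evalFrom_cons]
    by_cases hc : ∀ c, q = some c → P p c (some a)
    · have : (localDFA P).step (some (p, q)) a = some (q, some (some a)) := by
        simp only [localDFA, Option.bind_some]
        exact if_pos hc
      rw [this, ih]
      constructor
      · rintro ⟨h1, h2⟩
        refine ⟨by simpa using hc, ?_⟩
        rintro (_ | _ | i)
        · simpa using h1
        · simpa [prevTerm] using h2 0
        · simpa [prevTerm] using h2 (i + 1)
      · rintro ⟨h1, h2⟩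
        refine ⟨by simpa using h2 0, ?_⟩
        rintro (_ | i)
        · simpa [prevTerm] using h2 1
        · simpa [prevTerm] using h2 (i + 2)
    · have : (localDFA P).step (some (p, q)) a = none := by
        simp only [localDFA, Option.bind_some]
        exact if_neg hc
      rw [this, localDFA_evalFrom_none]
      constructor
      · rintro ⟨p', q', h, -⟩
        cases h
      · rintro ⟨h1, -⟩
        exact absurd (by simpa using h1) hc

theorem localLanguage_isRegular {α : Type} [Finite α]
    (P : Option (Option α) → Option α → Option α → Prop) : (localLanguage P).IsRegular := by
  refine ⟨_, Fintype.ofFinite _, localDFA P, ?_⟩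
  ext l
  refine (localDFA_evalFrom P l none none).trans ?_
  simp only [reduceCtorEq, false_imp_iff, implies_true, true_and]
  refine forall_congr' fun i => ?_
  cases i <;> rfl

/-- Myhill–Nerode: a left quotient of `{x}` is the singleton of a suffix of `x`, or empty. -/
theorem isRegular_singleton {α : Type} (x : List α) : Language.IsRegular ({x} : Set (List α)) := by
  apply Language.IsRegular.of_finite_range_leftQuotient
  refine Set.Finite.subset (((Set.finite_Iic x.length).image
    fun i => ({x.drop i} : Set (List α))).insert ∅) ?_
  rintro _ ⟨y, rfl⟩
  by_cases h : y <+: x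
  · obtain ⟨z, rfl⟩ := h
    refine Or.inr ⟨y.length, by simp, ?_⟩
    ext u
    change u ∈ ({_} : Set (List α)) ↔ y ++ u ∈ ({_} : Set (List α))
    simp
  · refine Or.inl ?_
    ext u
    change y ++ u ∈ ({_} : Set (List α)) ↔ _
    simp only [Set.mem_singleton_iff, Set.mem_empty_iff_false, iff_false]
    rintro rfl
    exact h ⟨u, rfl⟩

/-! ### Columns of a convolution -/

/-- The `i`-th column of the strings `v`, for all `i`. -/
def column {ι Γ : Type} (v : ι → List Γ) (i : ℕ) : ι → Option Γ := fun j => (v j)[i]?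

theorem column_eq_none_iff {ι Γ : Type} (v : ι → List Γ) (i : ℕ) :
    (column v i = fun _ => none) ↔ ∀ j, (v j).length ≤ i := by
  simp [funext_iff, column]

theorem column_injective {ι Γ : Type} {v v' : ι → List Γ} (h : ∀ i, column v i = column v' i) :
    v = v' := by
  ext1 j
  apply List.ext_getElem?
  intro i
  exact congrFun (h i) j

section

variable {ι Γ : Type} [Fintype ι]

open Classical in
theorem conv_getElem? (v : ι → List Γ) (i : ℕ) :
    (conv v)[i]? = if column v i = (fun _ => none) then none else some (column v i) := by
  unfold conv
  rw [List.getElem?_ofFn]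
  by_cases h : i < Finset.univ.sup fun j => (v j).length
  · rw [dif_pos h, if_neg]
    · rfl
    · rw [column_eq_none_iff]
      intro h'
      exact absurd h (not_lt.mpr (Finset.sup_le fun j _ => h' j))
  · rw [dif_neg h, if_pos]
    rw [column_eq_none_iff]
    intro j
    exact (Finset.le_sup (f := fun j => (v j).length) (Finset.mem_univ j)).trans (not_lt.mp h)

theorem conv_getD (v : ι → List Γ) (i : ℕ) :
    (conv v)[i]?.getD (fun _ => none) = column v i := by
  rw [conv_getElem?]
  split_ifs with h
  · exact h.symm
  · rfl

theorem conv_injective : Function.Injective (conv : (ι → List Γ) → List (ι → Option Γ)) := by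
  intro v v' h
  apply column_injective
  intro i
  rw [← conv_getD, ← conv_getD, h]


theorem conv_mem_convLanguage {R : Set (ι → List Γ)} {v : ι → List Γ} :
    conv v ∈ convLanguage R ↔ v ∈ R :=
  conv_injective.mem_set_image

end

/-- A string over `Option Γ` in which no letter follows a `none` stands for the string of its
letters, padded at its end. -/
theorem reduceOption_getElem? {Γ : Type} (d : List (Option Γ))
    (h : ∀ i : ℕ, d[i]?.join = none → d[i + 1]?.join = none) (i : ℕ) :
    d.reduceOption[i]? = d[i]?.join := by
  induction d generalizing i with
  | nil => simp
  | cons a d ih =>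
    have ih := ih fun i hi => by simpa using h (i + 1) (by simpa using hi)
    cases a with
    | none =>
      have hn : ∀ i : ℕ, (none :: d)[i]?.join = none := by
        intro i
        induction i with
        | zero => simp
        | succ i IH => exact h i IH
      rw [hn, List.reduceOption_cons_of_none, ih]
      simpa using hn (i + 1)
    | some a =>
      rw [List.reduceOption_cons_of_some]
      cases i with
      | zero => simp
      | succ i => simpa using ih i

/-- A relation is automatic if it is given by a condition on any three consecutive columns. -/
theorem isAutomaticRel_of_local {ι Γ : Type} [Fintype ι] [Finite Γ] (R : Set (ι → List Γ))
    (P : Option (ι → Option Γ) → (ι → Option Γ) → (ι → Option Γ) → Prop)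
    (h : ∀ v, v ∈ R ↔ ∀ i, P (prevTerm (column v) i) (column v i) (column v (i + 1))) :
    IsAutomaticRel R := by
  let e : Option (ι → Option Γ) → ι → Option Γ := fun c => c.getD fun _ => none
  -- The first two conditions of `Q` characterize convolutions: no letter is an all-padding column,
  -- and padding on a track is never followed by a letter.
  let Q : Option (Option (ι → Option Γ)) → Option (ι → Option Γ) → Option (ι → Option Γ) → Prop :=
    fun p c n => c ≠ some (fun _ => none) ∧ (∀ j, e c j = none → e n j = none) ∧
      P (p.map e) (e c) (e n)
  have key : convLanguage R = localLanguage Q := by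
    have hprev : ∀ v : ι → List Γ, ∀ i,
        (prevTerm (fun i => (conv v)[i]?) i).map e = prevTerm (column v) i := by
      rintro v (_ | i)
      · rfl
      · simp [prevTerm, e, conv_getD]
    ext l
    constructor
    · rintro ⟨v, hv, rfl⟩ i
      refine ⟨?_, ?_, ?_⟩
      · rw [conv_getElem?]
        split_ifs with h'
        · simp
        · simpa using h'
      · intro j
        simp only [e, conv_getD, column]
        simp only [List.getElem?_eq_none_iff]
        omega
      · rw [hprev]
        simpa only [e, conv_getD] using (h v).1 hv i
    · intro hl
      -- Deleting the padding of each track recovers the tuple, since padding occurs only at the end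
      -- of a track.
      let v : ι → List Γ := fun j => (l.map fun c => c j).reduceOption
      have hj : ∀ (i : ℕ) (j : ι), (l.map fun c => c j)[i]?.join = e l[i]? j := by
        intro i j
        rw [List.getElem?_map]
        cases l[i]? <;> rfl
      have hcol : ∀ i, column v i = e l[i]? := by
        intro i
        ext1 j
        rw [← hj]
        exact reduceOption_getElem? _ (fun i => by rw [hj, hj]; exact (hl i).2.1 j) i
      have hconv : conv v = l := by
        apply List.ext_getElem?
        intro i
        rw [conv_getElem?, hcol]
        have := (hl i).1
        cases hli : l[i]? with
        | none => exact if_pos rfl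
        | some c =>
          rw [hli] at this
          exact if_neg fun h' => this (congrArg some h')
      refine ⟨v, (h v).2 fun i => ?_, hconv⟩
      have := (hl i).2.2
      rw [← hconv, hprev] at this
      simpa only [e, conv_getD] using this
  rw [IsAutomaticRel, key]
  exact localLanguage_isRegular Q

/-! ### Some automatic functions and relations -/

/-- Apply a local rule, which sees a letter and its two neighbours, to all positions of a string,
including the first one after its end. -/
def localMap {Δ : Type} (φ : Option Δ → Option Δ → Option Δ → Δ) (x : List Δ) : List Δ :=
  List.ofFn (n := x.length + 1) fun i =>
    φ (prevTerm (fun i => x[i]?) i).join x[(i : ℕ)]? x[(i : ℕ) + 1]?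

-- The value `some none` of `prevTerm` says that the preceding position is already past the end of
-- `x`. This makes the length of the result, too, a condition on a window.
open Classical in
theorem localMap_getElem? {Δ : Type} (φ : Option Δ → Option Δ → Option Δ → Δ) (x : List Δ)
    (i : ℕ) : (localMap φ x)[i]? = if prevTerm (fun i => x[i]?) i = some none then none else
      some (φ (prevTerm (fun i => x[i]?) i).join x[i]? x[i + 1]?) := by
  unfold localMap
  rw [List.getElem?_ofFn]
  have : prevTerm (fun i => x[i]?) i = some none ↔ ¬ i < x.length + 1 := by
    cases i with
    | zero => simp [prevTerm]
    | succ i => simp [prevTerm]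
  by_cases h : i < x.length + 1
  · rw [dif_pos h, if_neg (this.not.2 (not_not.2 h))]
  · rw [dif_neg h, if_pos (this.2 h)]

open Classical in
theorem isAutomaticFn_localMap {Δ : Type} [Finite Δ] (φ : Option Δ → Option Δ → Option Δ → Δ) :
    IsAutomaticFn (k := 1) fun x => some (localMap φ (x 0)) := by
  refine isAutomaticRel_of_local _ (fun p c n => c 1 =
    if p.map (fun c => c 0) = some none then none else
      some (φ (p.map fun c => c 0).join (c 0) (n 0))) fun v => ?_
  have hprev : ∀ i, (prevTerm (column v) i).map (fun c => c 0) =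
      prevTerm (fun i => (v 0)[i]?) i := by
    rintro (_ | i) <;> rfl
  simp only [hprev, column, ← localMap_getElem?]
  change some (localMap φ (v 0)) = some (v 1) ↔ _
  rw [Option.some_inj]
  exact ⟨fun h i => by rw [h], fun h => List.ext_getElem? fun i => (h i).symm⟩

theorem isAutomaticFn_id {Γ : Type} [Finite Γ] :
    IsAutomaticFn (Γ := Γ) (k := 1) fun x => some (x 0) := by
  refine isAutomaticRel_of_local _ (fun _ c _ => c 0 = c 1) fun v => ?_
  change some (v 0) = some (v 1) ↔ _
  rw [Option.some_inj]
  exact ⟨fun h i => by simp [column, h], fun h => List.ext_getElem? h⟩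

theorem isAutomaticFn_const {Γ : Type} (u : List Γ) :
    IsAutomaticFn (Γ := Γ) (k := 0) fun _ => some u := by
  have : convLanguage (fnGraph (Γ := Γ) (k := 0) fun _ => some u) =
      ({conv fun _ => u} : Set (List (Fin 1 → Option Γ))) := by
    rw [convLanguage, ← Set.image_singleton]
    congr 1
    ext v
    change some u = some (v 0) ↔ v = fun _ => u
    rw [Option.some_inj, funext_iff]
    simp [eq_comm]
  rw [IsAutomaticFn, IsAutomaticRel, this]
  exact isRegular_singleton _

theorem isAutomaticRel_forall_mem {Δ : Type} [Finite Δ] (p : Δ → Prop) :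
    IsAutomaticRel {x : Fin 1 → List Δ | ∀ a ∈ x 0, p a} := by
  refine isAutomaticRel_of_local _ (fun _ c _ => ∀ a, c 0 = some a → p a) fun v => ?_
  change (∀ a ∈ v 0, p a) ↔ _
  simp only [List.mem_iff_getElem?, column]
  exact ⟨fun h i a ha => h a ⟨i, ha⟩, fun h a ⟨i, ha⟩ => h i a ha⟩

/-! ### Automata reading padded columns -/

/-- The preimage of a language under a partial substitution of letters by letters; the letters at
which `h` is undefined are skipped. -/
def filterMapPreimage {α β : Type} (h : β → Option α) (L : Language α) : Language β :=
  {l | l.filterMap h ∈ L}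

theorem mem_filterMapPreimage {α β : Type} {h : β → Option α} {L : Language α} {l : List β} :
    l ∈ filterMapPreimage h L ↔ l.filterMap h ∈ L :=
  Iff.rfl

theorem isRegular_filterMap {α β : Type} (h : β → Option α) {L : Language α} (hL : L.IsRegular) :
    (filterMapPreimage h L).IsRegular := by
  obtain ⟨σ, hσ, M, rfl⟩ := hL
  refine ⟨σ, hσ, ⟨fun s b => (h b).elim s (M.step s), M.start, M.accept⟩, ?_⟩
  ext l
  change List.foldl _ _ _ ∈ M.accept ↔ List.foldl _ _ _ ∈ M.accept
  rw [List.foldl_filterMap]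
  congr! 2
  ext s b
  change (h b).elim s (M.step s) = _
  cases h b <;> rfl

open Classical in
/-- Skip the columns that consist of padding symbols only. -/
noncomputable def nonPadding {ι Γ : Type} (c : ι → Option Γ) : Option (ι → Option Γ) :=
  if c = (fun _ => none) then none else some c

/-- An automaton for convolutions can therefore work on a tape that continues with blank cells, for
any sufficiently large `N`. -/
theorem filterMap_nonPadding {ι Γ : Type} [Fintype ι] (v : ι → List Γ) (N : ℕ)
    (hN : ∀ j, (v j).length ≤ N) :
    ((List.range N).map (column v)).filterMap nonPadding = conv v := by
  classical
  rw [conv]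
  set n := Finset.univ.sup fun j => (v j).length with hn
  have hle : n ≤ N := Finset.sup_le fun j _ => hN j
  obtain ⟨m, rfl⟩ := Nat.exists_eq_add_of_le hle
  rw [List.range_add, List.map_append, List.filterMap_append, List.map_map]
  have h1 : ∀ i, n ≤ i → column v i = fun _ => none := by
    intro i hi
    rw [column_eq_none_iff]
    intro j
    exact (Finset.le_sup (f := fun j => (v j).length) (Finset.mem_univ j)).trans hi
  have h2 : ∀ i < n, column v i ≠ fun _ => none := by
    intro i hi h
    rw [column_eq_none_iff] at h
    exact absurd hi (not_lt.mpr (Finset.sup_le fun j _ => h j))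
  have h3 : (List.map (column v ∘ fun x => n + x) (List.range m)).filterMap nonPadding = [] := by
    rw [List.filterMap_eq_nil_iff]
    intro c hc
    obtain ⟨i, -, rfl⟩ := List.mem_map.1 hc
    exact if_pos (h1 _ (Nat.le_add_right _ _))
  rw [h3, List.append_nil, List.filterMap_map, List.filterMap_congr (g := some ∘ column v)]
  · rw [List.filterMap_eq_map]
    apply List.ext_getElem?
    intro i
    rw [List.getElem?_map, List.getElem?_ofFn]
    by_cases hi : i < n
    · rw [List.getElem?_range hi, dif_pos hi]
      rfl
    · rw [dif_neg hi, List.getElem?_eq_none (by simpa using hi)]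
      rfl
  · intro i hi
    exact if_neg (h2 i (List.mem_range.1 hi))

/-! ### Turing machines are simulated by automatic register machines -/

namespace DTM

variable {A : Type} (M : DTM A)

/-- The first `N` cells of a tape as a string; the cell under the head also holds the state. -/
def encode (c : M.Config) (N : ℕ) : List (M.Γ × Option M.Q) :=
  List.ofFn (n := N) fun i => (c.tape i, if (i : ℕ) = c.head then some c.state else none)

theorem encode_getElem? (c : M.Config) (N i : ℕ) : (M.encode c N)[i]? =
    if i < N then some (c.tape i, if i = c.head then some c.state else none) else none := by
  unfold encode
  rw [List.getElem?_ofFn]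
  split_ifs <;> simp_all

open Classical in
/-- The state of the machine after a step made on the cell `x`, if the head is on `x` and then
moves in the direction `d`. -/
noncomputable def leaving (d : HeadMove) (x : M.Γ × Option M.Q) : Option M.Q :=
  x.2.bind fun q => if (M.δ q x.1).2.2 = d then some (M.δ q x.1).1 else none

open Classical in
/-- The content of a cell after a step, given its content and those of its two neighbours. -/
noncomputable def stepRule (p c n : Option (M.Γ × Option M.Q)) : M.Γ × Option M.Q :=
  (c.elim M.blank fun x => x.2.elim x.1 fun q => (M.δ q x.1).2.1,
    (p.bind (M.leaving .R)).or <| (n.bind (M.leaving .L)).or <| (c.bind (M.leaving .S)).or <|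
      -- In the cells that `localMap` produces, only the leftmost one has no left neighbour; there a
      -- left move leaves the head in place.
      if p = none then c.bind (M.leaving .L) else none)

open Classical in
/-- The content of a cell at the start, given the letter of the input on it. -/
noncomputable def initRule (p c _n : Option (M.Γ × Option M.Q)) : M.Γ × Option M.Q :=
  ((c.map Prod.fst).getD M.blank, if p = none then some M.qStart else none)

/-- The head is on one of the first `N` cells and the other cells are blank. -/
def Config.Within {M : DTM A} (c : M.Config) (N : ℕ) : Prop :=
  c.head < N ∧ ∀ i, N ≤ i → c.tape i = M.blank

theorem within_init (w : List A) : (M.init w).Within (w.length + 1) := by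
  refine ⟨Nat.succ_pos _, fun i hi => ?_⟩
  change (w.map M.incl).getD i M.blank = _
  rw [List.getD_eq_default]
  simp only [List.length_map]
  omega

theorem localMap_initRule (w : List A) :
    localMap M.initRule (w.map fun a => (M.incl a, none)) = M.encode (M.init w) (w.length + 1) := by
  apply List.ext_getElem?
  intro i
  rw [localMap_getElem?, encode_getElem?]
  cases i with
  | zero =>
    cases w <;> simp [prevTerm, initRule, init]
  | succ i =>
    by_cases hi : i < w.length
    · simp [prevTerm, initRule, init, List.getD_eq_getElem?_getD, hi, Function.comp_def]
    · simp [prevTerm, hi]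

theorem step_of_not_halted {c : M.Config} (h : ¬ (c.state = M.qAccept ∨ c.state = M.qReject)) :
    M.step c = ⟨(M.δ c.state (c.tape c.head)).1,
      moveHead c.head (M.δ c.state (c.tape c.head)).2.2,
      Function.update c.tape c.head (M.δ c.state (c.tape c.head)).2.1⟩ := by
  unfold step
  rw [if_neg h]

theorem within_step {c : M.Config} {N : ℕ} (hc : c.Within N) : (M.step c).Within (N + 1) := by
  by_cases h : c.state = M.qAccept ∨ c.state = M.qReject
  · rw [step, if_pos h]
    exact ⟨hc.1.trans (Nat.lt_succ_self _), fun i hi => hc.2 i (Nat.le_of_succ_le hi)⟩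
  · rw [step_of_not_halted M h]
    have h1 := hc.1
    refine ⟨?_, fun i hi => ?_⟩
    · dsimp only
      cases (M.δ c.state (c.tape c.head)).2.2 <;> simp only [moveHead] <;> omega
    · dsimp only
      rw [Function.update_of_ne (by omega)]
      exact hc.2 i (by omega)

/-- The head moves by at most one cell and the string grows by one cell, so the head stays on the
string; the new cell is blank by `hc`. -/
theorem localMap_stepRule {c : M.Config} {N : ℕ} (hc : c.Within N)
    (h : ¬ (c.state = M.qAccept ∨ c.state = M.qReject)) :
    localMap M.stepRule (M.encode c N) = M.encode (M.step c) (N + 1) := by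
  classical
  rw [step_of_not_halted M h]
  obtain ⟨h1, h2⟩ := hc
  apply List.ext_getElem?
  intro i
  rw [localMap_getElem?, M.encode_getElem? _ (N + 1)]
  generalize hd : M.δ c.state (c.tape c.head) = d
  obtain ⟨q', a, D⟩ := d
  by_cases hi : i < N + 1
  swap
  · rw [if_neg hi, if_pos]
    obtain ⟨j, rfl⟩ : ∃ j, i = j + 1 := ⟨i - 1, by omega⟩
    rw [prevTerm, encode_getElem?, if_neg (by omega)]
  have hprev : prevTerm (fun i => (M.encode c N)[i]?) i ≠ some none := by
    cases i with
    | zero => simp [prevTerm]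
    | succ i => rw [prevTerm, encode_getElem?, if_pos (by omega)]; simp
  rw [if_pos hi, if_neg hprev, Option.some_inj]
  have hsym : ∀ j, j ≤ N → ((M.encode c N)[j]?.elim M.blank fun x => x.2.elim x.1 fun q =>
      (M.δ q x.1).2.1) = Function.update c.tape c.head a j := by
    intro j hj
    rw [encode_getElem?]
    by_cases hjN : j < N
    · by_cases hjh : j = c.head
      · subst hjh
        simp [hjN, hd]
      · simp [hjN, hjh]
    · rw [if_neg hjN, Function.update_of_ne (by omega)]
      exact (h2 j (by omega)).symm
  -- Only the scanned cell, with the actual direction `D`, yields a state, so the new head position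
  -- reduces to arithmetic on `c.head`.
  have hleave : ∀ j E, (M.encode c N)[j]?.bind (M.leaving E) =
      if j = c.head ∧ D = E then some q' else none := by
    intro j E
    rw [encode_getElem?]
    by_cases hjN : j < N
    · by_cases hjh : j = c.head
      · subst hjh
        simp [hjN, leaving, hd]
      · simp [hjN, hjh, leaving]
    · rw [if_neg hjN, if_neg (by omega)]
      rfl
  rw [stepRule, hsym i (by omega), hleave, hleave, hleave]
  refine Prod.ext rfl ?_
  dsimp only
  cases i with
  | zero =>
    simp only [prevTerm, Option.join_none, Option.bind_none, Option.none_or, zero_add, if_true]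
    clear hsym hleave hprev hd h2
    cases D <;> simp [moveHead] <;> grind
  | succ i =>
    have : (M.encode c N)[i]? ≠ none := by
      rw [encode_getElem?, if_pos (by omega)]; simp
    simp only [prevTerm, Option.join_some, hleave]
    clear hsym hleave hprev hd h2
    cases D <;> simp [moveHead] <;> grind

/-- The register machine that holds the tape of `M` in its only register. -/
noncomputable def toDARM : DARM A where
  Γ := M.Γ × Option M.Q
  finΓ := have := M.finΓ; have := M.finQ; inferInstance
  incl := ⟨fun a => (M.incl a, none), fun _ _ h => M.incl.injective (congrArg Prod.fst h)⟩
  r := 1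
  F := Bool
  finF := inferInstance
  fa _ := 1
  fn b x := some (localMap (if b then M.stepRule else M.initRule) (x 0))
  fn_automatic _ := have := M.finΓ; have := M.finQ; isAutomaticFn_localMap _
  T := Bool
  finT := inferInstance
  ta _ := 1
  test b := {x | ∀ a ∈ x 0, a.2 ≠ some (if b then M.qAccept else M.qReject)}
  test_automatic _ := have := M.finΓ; have := M.finQ; isAutomaticRel_forall_mem _
  -- The tests hold when the halting state is absent from the tape, so their jumps skip the halting
  -- instructions. One round of the loop takes four instructions.
  prog := [.read 0, .apply 0 false fun _ => 0, .ifGoto true (fun _ => 0) 4, .haltAccept,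
    .ifGoto false (fun _ => 0) 6, .haltReject, .apply 0 true fun _ => 0, .goto 2]

/-- The configuration of `M.toDARM` at line `l` with register content `x`. -/
def darmConfig (l : ℕ) (x : List (M.Γ × Option M.Q)) : M.toDARM.Config :=
  ⟨.line l, fun _ => x, []⟩

theorem forall_mem_encode {c : M.Config} {N : ℕ} (hc : c.Within N) (q : M.Q) :
    (∀ a ∈ M.encode c N, a.2 ≠ some q) ↔ c.state ≠ q := by
  simp only [List.mem_iff_getElem?, encode_getElem?]
  constructor
  · intro h hq
    exact h _ ⟨c.head, if_pos hc.1⟩ (by simp [hq])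
  · rintro h a ⟨i, hi⟩
    split_ifs at hi
    · cases hi
      simpa using h
    · cases hi
      simp

section

variable (w : List A) (x : List (M.Γ × Option M.Q))

theorem update_darm (y : List (M.Γ × Option M.Q)) :
    Function.update (fun _ : Fin 1 => x) 0 y = fun _ => y := by
  ext1 i
  rw [Subsingleton.elim i 0, Function.update_self]

theorem darm_step_zero :
    M.toDARM.step w (M.darmConfig 0 x) = M.darmConfig 1 (w.map fun a => (M.incl a, none)) :=
  congrArg (fun r => (⟨.line 1, r, []⟩ : M.toDARM.Config)) (M.update_darm x _)

theorem darm_step_one :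
    M.toDARM.step w (M.darmConfig 1 x) = M.darmConfig 2 (localMap M.initRule x) :=
  congrArg (fun r => (⟨.line 2, r, []⟩ : M.toDARM.Config)) (M.update_darm x _)

theorem darm_step_six :
    M.toDARM.step w (M.darmConfig 6 x) = M.darmConfig 7 (localMap M.stepRule x) :=
  congrArg (fun r => (⟨.line 7, r, []⟩ : M.toDARM.Config)) (M.update_darm x _)

theorem darm_step_two_pos (h : ∀ a ∈ x, a.2 ≠ some M.qAccept) :
    M.toDARM.step w (M.darmConfig 2 x) = M.darmConfig 4 x :=
  if_pos h

theorem darm_step_two_neg (h : ¬ ∀ a ∈ x, a.2 ≠ some M.qAccept) :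
    M.toDARM.step w (M.darmConfig 2 x) = M.darmConfig 3 x :=
  if_neg h

theorem darm_step_four_pos (h : ∀ a ∈ x, a.2 ≠ some M.qReject) :
    M.toDARM.step w (M.darmConfig 4 x) = M.darmConfig 6 x :=
  if_pos h

theorem darm_step_four_neg (h : ¬ ∀ a ∈ x, a.2 ≠ some M.qReject) :
    M.toDARM.step w (M.darmConfig 4 x) = M.darmConfig 5 x :=
  if_neg h

end

/-- One round of the loop per Turing step gives `4 * m`. Once `M` has halted, two instructions
detect and report acceptance, and three do so for rejection. -/
theorem darm_simulates (w : List A) (m : ℕ) (c : M.Config) (N : ℕ) (hc : c.Within N) :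
    ((M.step^[m] c).state = M.qAccept → ∃ m' ≤ 4 * m + 3,
      ((M.toDARM.step w)^[m'] (M.darmConfig 2 (M.encode c N))).status = .accepted) ∧
    ((M.step^[m] c).state = M.qReject → ∃ m' ≤ 4 * m + 3,
      ((M.toDARM.step w)^[m'] (M.darmConfig 2 (M.encode c N))).status = .rejected) := by
  by_cases ha : c.state = M.qAccept
  · have hfix : ∀ m, M.step^[m] c = c := fun m =>
      Function.iterate_fixed (by rw [step, if_pos (Or.inl ha)]) m
    rw [hfix, ha]
    refine ⟨fun _ => ⟨2, by omega, ?_⟩, fun h => absurd h M.accept_ne_reject⟩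
    rw [Function.iterate_succ_apply, Function.iterate_one, darm_step_two_neg]
    · rfl
    · rw [forall_mem_encode M hc]
      exact not_not.2 ha
  have h2 : M.toDARM.step w (M.darmConfig 2 (M.encode c N)) = M.darmConfig 4 (M.encode c N) := by
    rw [darm_step_two_pos]
    rwa [forall_mem_encode M hc]
  by_cases hr : c.state = M.qReject
  · have hfix : ∀ m, M.step^[m] c = c := fun m =>
      Function.iterate_fixed (by rw [step, if_pos (Or.inr hr)]) m
    rw [hfix, hr]
    refine ⟨fun h => absurd h.symm M.accept_ne_reject, fun _ => ⟨3, by omega, ?_⟩⟩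
    rw [Function.iterate_succ_apply, h2, Function.iterate_succ_apply, Function.iterate_one,
      darm_step_four_neg]
    · rfl
    · rw [forall_mem_encode M hc]
      exact not_not.2 hr
  have h4 : M.toDARM.step w (M.darmConfig 4 (M.encode c N)) = M.darmConfig 6 (M.encode c N) := by
    rw [darm_step_four_pos]
    rwa [forall_mem_encode M hc]
  have hloop : (M.toDARM.step w)^[4] (M.darmConfig 2 (M.encode c N)) =
      M.darmConfig 2 (M.encode (M.step c) (N + 1)) := by
    rw [← localMap_stepRule M hc (by tauto)]
    simp only [Function.iterate_succ_apply, h2, h4, darm_step_six]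
    rfl
  cases m with
  | zero => exact ⟨fun h => absurd h ha, fun h => absurd h hr⟩
  | succ m =>
    obtain ⟨iha, ihr⟩ := darm_simulates w m (M.step c) (N + 1) (M.within_step hc)
    rw [Function.iterate_succ_apply]
    constructor
    · intro h
      obtain ⟨m', hm', h'⟩ := iha h
      refine ⟨m' + 4, by omega, ?_⟩
      rwa [Function.iterate_add_apply, hloop]
    · intro h
      obtain ⟨m', hm', h'⟩ := ihr h
      refine ⟨m' + 4, by omega, ?_⟩
      rwa [Function.iterate_add_apply, hloop]

/-- Reading the input and laying out the tape account for two more instructions than in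
`darm_simulates`. -/
theorem toDARM_recognizesIn {L : Language A} {t : ℕ → ℕ} (h : M.DecidesIn L t) :
    M.toDARM.RecognizesIn L fun n => 4 * t n + 5 := by
  intro w
  have hstart : (M.toDARM.step w)^[2] M.toDARM.init =
      M.darmConfig 2 (M.encode (M.init w) (w.length + 1)) := by
    change M.toDARM.step w (M.toDARM.step w (M.darmConfig 0 [])) = _
    rw [darm_step_zero, darm_step_one, localMap_initRule]
  have hsim := fun m => M.darm_simulates w m (M.init w) _ (M.within_init w)
  constructor
  · intro hw
    obtain ⟨m, hm, hacc⟩ := (h w).1 hw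
    obtain ⟨m', hm', h'⟩ := (hsim m).1 hacc
    refine ⟨m' + 2, by dsimp only; omega, ?_⟩
    rwa [DARM.run, Function.iterate_add_apply, hstart]
  · intro hw
    obtain ⟨m, hm, hrej⟩ := (h w).2 hw
    obtain ⟨m', hm', h'⟩ := (hsim m).2 hrej
    refine ⟨m' + 2, by dsimp only; omega, ?_⟩
    rwa [DARM.run, Function.iterate_add_apply, hstart]

end DTM

/-! ### Growth of powers and the first inclusion -/

theorem one_isBigO_natCast_pow (k : ℕ) :
    (fun _ : ℕ => (1 : ℝ)) =O[atTop] fun n : ℕ => (n : ℝ) ^ k := by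
  refine IsBigO.of_bound 1 ?_
  filter_upwards [eventually_ge_atTop 1] with n hn
  rw [one_mul, norm_one, Real.norm_of_nonneg (by positivity)]
  exact one_le_pow₀ (by exact_mod_cast hn)

theorem PTIME_subset_DALPoly (A : Type) : PTIME A ⊆ DALPoly A := by
  intro L hL
  obtain ⟨k, M, t, ht, hM⟩ := Set.mem_iUnion.1 hL
  refine Set.mem_iUnion.2 ⟨k, M.toDARM, _, ?_, M.toDARM_recognizesIn hM⟩
  have := (ht.const_mul_left 4).add ((one_isBigO_natCast_pow k).const_mul_left 5)
  simpa using this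

/-! ### Automata that check a guessed result -/

/-- The graph automaton reads the argument tracks selected by `g` and the guess `d`, skipping blank
columns. It accepts exactly when `d` is the value padded to length `N`. -/
theorem exists_language_fn {Γ κ : Type} [Finite Γ] {k : ℕ}
    {f : (Fin k → List Γ) → Option (List Γ)} (hf : IsAutomaticFn f) (g : Fin k → κ) :
    ∃ K : Language ((κ → Option Γ) × Option Γ), K.IsRegular ∧
      ∀ (v : κ → List Γ) (N : ℕ) (d : ℕ → Option Γ), (∀ j, (v j).length ≤ N) →
        ((List.range N).map (fun i => (column v i, d i)) ∈ K ↔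
          ∃ y, f (fun j => v (g j)) = some y ∧ y.length ≤ N ∧ ∀ i < N, d i = y[i]?) := by
  let h₁ : (κ → Option Γ) × Option Γ → Option (Fin (k + 1) → Option Γ) := fun c =>
    nonPadding (Fin.snoc (α := fun _ => Option Γ) (fun j => c.1 (g j)) c.2)
  -- Needed because blank columns are skipped: a guess with a gap beyond the arguments would
  -- otherwise pass for the string without the gap.
  let Q : Option (Option (Option Γ)) → Option (Option Γ) → Option (Option Γ) → Prop :=
    fun _ c n => c.join = none → n.join = none
  refine ⟨_, (isRegular_filterMap h₁ hf).inf
    (isRegular_filterMap (fun c => some c.2) (localLanguage_isRegular Q)), ?_⟩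
  intro v N d hN
  have hcol : ∀ y : List Γ, (∀ i < N, d i = y[i]?) → y.length ≤ N →
      ((List.range N).map (fun i => (column v i, d i))).filterMap h₁ =
        conv (Fin.snoc (α := fun _ => List Γ) (fun j => v (g j)) y) := by
    intro y hy hyN
    rw [← filterMap_nonPadding _ N, List.filterMap_map, List.filterMap_map]
    · apply List.filterMap_congr
      intro i hi
      simp only [Function.comp_def, h₁, hy i (List.mem_range.1 hi)]
      congr 1
      ext1 j
      refine Fin.lastCases ?_ (fun j => ?_) j
      · simp [column]
      · simp [column]
    · intro j
      refine Fin.lastCases ?_ (fun j => ?_) j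
      · simpa using hyN
      · simpa using hN (g j)
  have hgraph : ∀ y : List Γ, conv (Fin.snoc (α := fun _ => List Γ) (fun j => v (g j)) y) ∈
      convLanguage (fnGraph f) ↔ f (fun j => v (g j)) = some y := by
    intro y
    rw [conv_mem_convLanguage]
    simp [fnGraph]
  have hd : ((List.range N).map (fun i => (column v i, d i))).filterMap (fun c => some c.2) =
      (List.range N).map d := by
    rw [List.filterMap_map, ← List.filterMap_eq_map]
    rfl
  have hdi : ∀ i, ((List.range N).map d)[i]?.join = if i < N then d i else none := by
    intro i
    rw [List.getElem?_map]
    split_ifs with hi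
    · rw [List.getElem?_range hi]
      rfl
    · rw [List.getElem?_eq_none (by simpa using hi)]
      rfl
  rw [Language.mem_inf, mem_filterMapPreimage, mem_filterMapPreimage]
  constructor
  · rintro ⟨h1, h2⟩
    rw [hd] at h2
    have hy : ∀ i, ((List.range N).map d).reduceOption[i]? = if i < N then d i else none := by
      intro i
      rw [reduceOption_getElem? _ h2, hdi]
    have hyN : ((List.range N).map d).reduceOption.length ≤ N :=
      (List.reduceOption_length_le _).trans (by simp)
    have hyd : ∀ i < N, d i = ((List.range N).map d).reduceOption[i]? := by
      intro i hi
      rw [hy, if_pos hi]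
    rw [hcol _ hyd hyN, hgraph] at h1
    exact ⟨_, h1, hyN, hyd⟩
  · rintro ⟨y, hfy, hyN, hyd⟩
    refine ⟨?_, ?_⟩
    · rwa [hcol y hyd hyN, hgraph]
    · rw [hd]
      intro i
      have : ∀ i : ℕ, ((List.range N).map d)[i]?.join = y[i]? := by
        intro i
        rw [hdi]
        split_ifs with hi
        · exact hyd i hi
        · rw [List.getElem?_eq_none (by omega)]
      simp only [Q, this, List.getElem?_eq_none_iff]
      omega

/-- The guess is ignored, so tests and functions can share one alphabet and one kind of sweep. -/
theorem exists_language_rel {Γ κ : Type} {k : ℕ} {R : Set (Fin k → List Γ)}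
    (hR : IsAutomaticRel R) (g : Fin k → κ) :
    ∃ K : Language ((κ → Option Γ) × Option Γ), K.IsRegular ∧
      ∀ (v : κ → List Γ) (N : ℕ) (d : ℕ → Option Γ), (∀ j, (v j).length ≤ N) →
        ((List.range N).map (fun i => (column v i, d i)) ∈ K ↔ (fun j => v (g j)) ∈ R) := by
  refine ⟨_, isRegular_filterMap (fun c => nonPadding fun j => c.1 (g j)) hR, ?_⟩
  intro v N d hN
  rw [← conv_mem_convLanguage, ← filterMap_nonPadding _ N fun j => hN (g j), mem_filterMapPreimage]
  rw [List.filterMap_map, List.filterMap_map]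
  rfl

/-- Finitely many regular languages are recognized by one automaton with several sets of
accepting states. -/
theorem exists_common_automaton {α Λ : Type} [Finite Λ] (K : Λ → Language α)
    (hK : ∀ l, (K l).IsRegular) :
    ∃ (σ : Type) (_ : Finite σ) (stp : σ → α → σ) (s₀ : σ) (acc : Λ → Set σ),
      ∀ l x, x ∈ K l ↔ x.foldl stp s₀ ∈ acc l := by
  choose σ hσ M hM using hK
  have := fun l => hσ l
  refine ⟨∀ l, σ l, inferInstance, fun s a l => (M l).step (s l) a, fun l => (M l).start,
    fun l => {s | s l ∈ (M l).accept}, fun l x => ?_⟩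
  have : ∀ s : ∀ l, σ l, x.foldl (fun s a l => (M l).step (s l) a) s l =
      x.foldl (M l).step (s l) := by
    induction x with
    | nil => exact fun _ => rfl
    | cons a x ih => exact fun s => ih _
  change _ ↔ (x.foldl (fun s a l => (M l).step (s l) a) fun l => (M l).start) l ∈ (M l).accept
  rw [this, ← hM l]
  rfl

/-- A sequence of iterates in a finite type that meets a set does so early. -/
theorem exists_iterate_mem_of_card {X : Type} [Finite X] (f : X → X) (x : X) (s : Set X)
    (h : ∃ n, f^[n] x ∈ s) : ∃ n < Nat.card X, f^[n] x ∈ s := by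
  classical
  by_contra hcon
  have hmin : Nat.card X ≤ Nat.find h := by
    by_contra hlt
    exact hcon ⟨_, not_le.1 hlt, Nat.find_spec h⟩
  have hlt : Nat.card X < Nat.card (Fin (Nat.find h + 1)) := by
    rw [Nat.card_fin]
    omega
  obtain ⟨i, j, hij, hne⟩ : ∃ i j : Fin (Nat.find h + 1), f^[i] x = f^[j] x ∧ i < j := by
    have := Fintype.ofFinite X
    rw [Nat.card_eq_fintype_card, Nat.card_eq_fintype_card] at hlt
    obtain ⟨i, j, hne, heq⟩ :=
      Fintype.exists_ne_map_eq_of_card_lt (fun i : Fin (Nat.find h + 1) => f^[i] x) hlt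
    rcases lt_or_gt_of_ne hne with h' | h'
    · exact ⟨i, j, heq, h'⟩
    · exact ⟨j, i, heq.symm, h'⟩
  -- Cutting out the segment between the repeated values at `i < j` gives an earlier hit.
  refine Nat.find_min h (m := Nat.find h - j + i) ?_ ?_
  · have := j.2
    have : (i : ℕ) < j := hne
    omega
  · rw [Function.iterate_add_apply, hij, ← Function.iterate_add_apply,
      Nat.sub_add_cancel (Nat.lt_succ_iff.1 j.2)]
    exact Nat.find_spec h

/-! ### Turing machines sweeping over a multi-track tape -/

/-- What a sweeping machine does at a line: compute a string, store it on a track and go to the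
next line, or go to one of two lines, or stop. -/
inductive SweepAction (κ Λ : Type) : Type
  | store (i : κ) (next : Λ)
  | branch (yes no : Λ)
  | accept
  | reject
  | stuck

/-- A machine whose tape has the tracks `κ`, each holding a string over `Γ`, and whose program has
the lines `Λ`. The automaton reads the columns of the tape together with a guessed letter; the
string to be stored at line `l` is the one whose letters, if guessed, lead to acceptance by
`acc l`. -/
structure Sweeper (Γ κ Λ σ : Type) where
  stp : σ → (κ → Option Γ) × Option Γ → σ
  s₀ : σ
  acc : Λ → Set σ
  act : Λ → SweepAction κ Λ
  l₀ : Λ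

/-- The states of the Turing machine of a `Sweeper`. -/
inductive SweepState (κ Λ σ : Type) : Type
  | start
  | fwd (l : Λ) (S : Set σ)
  | back (i : κ) (l : Λ) (q : σ)
  | rewind (l : Λ)
  | accept
  | reject
  | stuck

/-- The tape cells: a mark for the leftmost cell, a column, and a set of states of the automaton. -/
abbrev SweepCell (Γ κ σ : Type) : Type := Bool × (κ → Option Γ) × Set σ

instance {κ Λ σ : Type} [Finite κ] [Finite Λ] [Finite σ] : Finite (SweepState κ Λ σ) := by
  let e : SweepState κ Λ σ → Fin 4 ⊕ (Λ × Set σ) ⊕ (κ × Λ × σ) ⊕ Λ := fun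
    | .start => .inl 0
    | .accept => .inl 1
    | .reject => .inl 2
    | .stuck => .inl 3
    | .fwd l S => .inr (.inl (l, S))
    | .back i l q => .inr (.inr (.inl (i, l, q)))
    | .rewind l => .inr (.inr (.inr l))
  refine Finite.of_injective e fun x y h => ?_
  cases x <;> cases y <;> simp_all [e]

namespace Sweeper

variable {Γ κ Λ σ : Type} (X : Sweeper Γ κ Λ σ)

/-- The states reached from `S` by reading the column `c` and guessing a letter. -/
def next (S : Set σ) (c : κ → Option Γ) : Set σ :=
  {t | ∃ s ∈ S, ∃ d, X.stp s (c, d) = t}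

/-- The states reached by reading the first columns of `v` and guessing letters. -/
def reach (v : κ → List Γ) : ℕ → Set σ
  | 0 => {X.s₀}
  | i + 1 => X.next (reach v i) (column v i)

/-- The state reached after the first `N` columns of `v`, the guessed letters being `d`. -/
def path (v : κ → List Γ) (d : ℕ → Option Γ) (N : ℕ) : σ :=
  ((List.range N).map fun i => (column v i, d i)).foldl X.stp X.s₀

theorem path_succ (v : κ → List Γ) (d : ℕ → Option Γ) (N : ℕ) :
    X.path v d (N + 1) = X.stp (X.path v d N) (column v N, d N) := by
  simp [path, List.range_succ]

theorem path_mem_reach (v : κ → List Γ) (d : ℕ → Option Γ) (N : ℕ) :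
    X.path v d N ∈ X.reach v N := by
  induction N with
  | zero => rfl
  | succ N ih => exact ⟨_, ih, d N, (X.path_succ v d N).symm⟩

theorem path_congr (v : κ → List Γ) {d d' : ℕ → Option Γ} {N : ℕ} (h : ∀ i < N, d i = d' i) :
    X.path v d N = X.path v d' N := by
  unfold path
  congr 1
  exact List.map_congr_left fun i hi => by rw [h i (List.mem_range.1 hi)]

open Classical in
theorem exists_path_of_mem_reach (v : κ → List Γ) {N : ℕ} {q : σ} (h : q ∈ X.reach v N) :
    ∃ d, X.path v d N = q := by
  induction N generalizing q with
  | zero => exact ⟨fun _ => none, h.symm⟩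
  | succ N ih =>
    obtain ⟨s, hs, a, rfl⟩ := h
    obtain ⟨d, rfl⟩ := ih hs
    refine ⟨Function.update d N a, ?_⟩
    rw [path_succ, Function.update_self]
    congr 1
    exact X.path_congr v fun i hi => Function.update_of_ne hi.ne _ _

/-- Past the longest string every column is blank, so the sets evolve under one fixed map on the
finite type `Set σ`. -/
theorem reach_add (v : κ → List Γ) {B : ℕ} (hB : ∀ j, (v j).length ≤ B) (n : ℕ) :
    X.reach v (B + n) = (fun S => X.next S fun _ => none)^[n] (X.reach v B) := by
  induction n with
  | zero => rfl
  | succ n ih =>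
    rw [Function.iterate_succ_apply', ← ih, ← (column_eq_none_iff v (B + n)).2 fun j =>
      (hB j).trans (Nat.le_add_right _ _)]
    rfl

/-- The state in which the machine performs the line `l`. -/
def enter (l : Λ) : SweepState κ Λ σ :=
  match X.act l with
  | .accept => .accept
  | .reject => .reject
  | .stuck => .stuck
  | _ => .fwd l {X.s₀}

/-- The forward sweep ends at the first blank cell where the guessed string may be complete. -/
def StopsAt (l : Λ) (b : Bool) (c : κ → Option Γ) (S : Set σ) : Prop :=
  b = false ∧ (c = fun _ => none) ∧ ∀ i l', X.act l = .store i l' → (S ∩ X.acc l).Nonempty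

open Classical in
/-- The state after the forward sweep. -/
noncomputable def turn (l : Λ) (S : Set σ) : SweepState κ Λ σ :=
  match X.act l with
  | .store i l' => .back i l' (@Classical.epsilon σ ⟨X.s₀⟩ fun q => q ∈ S ∩ X.acc l)
  | .branch yes no => .rewind (if (S ∩ X.acc l).Nonempty then yes else no)
  | _ => .stuck

/-- A state in `S` and a letter that lead to `q` upon reading the column `c`. -/
noncomputable def predecessor (S : Set σ) (c : κ → Option Γ) (q : σ) : σ × Option Γ :=
  @Classical.epsilon _ ⟨(X.s₀, none)⟩ fun p => p.1 ∈ S ∧ X.stp p.1 (c, p.2) = q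

theorem predecessor_spec {S : Set σ} {c : κ → Option Γ} {q : σ} (h : q ∈ X.next S c) :
    (X.predecessor S c q).1 ∈ S ∧
      X.stp (X.predecessor S c q).1 (c, (X.predecessor S c q).2) = q := by
  obtain ⟨s, hs, d, hd⟩ := h
  exact Classical.epsilon_spec (p := fun p : σ × Option Γ => p.1 ∈ S ∧ X.stp p.1 (c, p.2) = q)
    ⟨(s, d), hs, hd⟩

open Classical in
/-- The transition function of the Turing machine. -/
noncomputable def delta :
    SweepState κ Λ σ → SweepCell Γ κ σ → SweepState κ Λ σ × SweepCell Γ κ σ × HeadMove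
  -- The input comes without a mark; the first step marks the leftmost cell.
  | .start, x => (X.enter X.l₀, (true, x.2), .S)
  | .fwd l S, x =>
    if X.StopsAt l x.1 x.2.1 S then (X.turn l S, (x.1, x.2.1, ∅), .L)
    else (.fwd l (X.next S x.2.1), (x.1, x.2.1, S), .R)
  -- On the marked cell the left move keeps the head in place, ready for the next line. The stored
  -- sets are erased on the way.
  | .back i l q, x =>
    (if x.1 then X.enter l else .back i l (X.predecessor x.2.2 x.2.1 q).1,
      (x.1, Function.update x.2.1 i (X.predecessor x.2.2 x.2.1 q).2, ∅), .L)
  | .rewind l, x => (if x.1 then X.enter l else .rewind l, (x.1, x.2.1, ∅), .L)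
  | q, x => (q, x, .S)

theorem delta_fwd_of_stopsAt {l : Λ} {S : Set σ} {x : SweepCell Γ κ σ}
    (h : X.StopsAt l x.1 x.2.1 S) :
    X.delta (.fwd l S) x = (X.turn l S, (x.1, x.2.1, ∅), .L) :=
  if_pos h

theorem delta_fwd_of_not_stopsAt {l : Λ} {S : Set σ} {x : SweepCell Γ κ σ}
    (h : ¬ X.StopsAt l x.1 x.2.1 S) :
    X.delta (.fwd l S) x = (.fwd l (X.next S x.2.1), (x.1, x.2.1, S), .R) :=
  if_neg h

open Classical in
/-- The Turing machine of a `Sweeper`; its input is on the track `i₀`. -/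
noncomputable def toDTM {A : Type} [Finite Γ] [Finite κ] [Finite Λ] [Finite σ] (incl : A ↪ Γ)
    (i₀ : κ) : DTM A where
  Γ := SweepCell Γ κ σ
  finΓ := inferInstance
  incl := ⟨fun a => (false, Function.update (fun _ => none) i₀ (some (incl a)), ∅), fun a b h => by
    have := congrFun (congrArg (fun x : SweepCell Γ κ σ => x.2.1) h) i₀
    simpa using this⟩
  blank := (false, fun _ => none, ∅)
  incl_ne_blank a h := by
    have : Function.update (fun _ => none) i₀ (some (incl a)) i₀ = none :=
      congrFun (congrArg (fun x : SweepCell Γ κ σ => x.2.1) h) i₀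
    simp at this
  Q := SweepState κ Λ σ
  finQ := inferInstance
  qStart := .start
  qAccept := .accept
  qReject := .reject
  accept_ne_reject := by simp
  δ := X.delta

/-- Cell `B + n` qualifies, so the first qualifying cell is not later. Cell `0` is excluded so that
turning at `N` leads to cell `N - 1`, the last one with a guess; `1 ≤ B` keeps `B + n` admissible.
-/
theorem exists_turningPoint (l : Λ) (v : κ → List Γ) {B : ℕ} (hB : ∀ j, (v j).length ≤ B) (hB1 : 1 ≤ B)
    {n : ℕ} (hn : ∀ i l', X.act l = .store i l' → (X.reach v (B + n) ∩ X.acc l).Nonempty) :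
    ∃ N, 1 ≤ N ∧ N ≤ B + n ∧ X.StopsAt l (decide (N = 0)) (column v N) (X.reach v N) ∧
      ∀ i < N, ¬ X.StopsAt l (decide (i = 0)) (column v i) (X.reach v i) := by
  classical
  have h : ∃ N, X.StopsAt l (decide (N = 0)) (column v N) (X.reach v N) := by
    refine ⟨B + n, ?_, ?_, hn⟩
    · simp only [decide_eq_false_iff_not]
      omega
    · exact (column_eq_none_iff _ _).2 fun j => (hB j).trans (Nat.le_add_right _ _)
  refine ⟨Nat.find h, ?_, Nat.find_min' h ?_, Nat.find_spec h, fun i hi => Nat.find_min h hi⟩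
  · have := (Nat.find_spec h).1
    rw [decide_eq_false_iff_not] at this
    omega
  · refine ⟨?_, ?_, hn⟩
    · simp only [decide_eq_false_iff_not]
      omega
    · exact (column_eq_none_iff _ _).2 fun j => (hB j).trans (Nat.le_add_right _ _)

/-- The tape with the strings `v` and the sets of states `T`. -/
def tapeOf (v : κ → List Γ) (T : ℕ → Set σ) : ℕ → SweepCell Γ κ σ :=
  fun k => (decide (k = 0), column v k, T k)

section

variable {A : Type} [Finite Γ] [Finite κ] [Finite Λ] [Finite σ] (incl : A ↪ Γ) (i₀ : κ)

/-- A configuration of the Turing machine. -/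
def config (q : SweepState κ Λ σ) (h : ℕ) (tape : ℕ → SweepCell Γ κ σ) :
    (X.toDTM incl i₀).Config :=
  ⟨q, h, tape⟩

/-- A configuration in which the machine is about to perform the line `l`. -/
def lineConfig (l : Λ) (v : κ → List Γ) : (X.toDTM incl i₀).Config :=
  X.config incl i₀ (X.enter l) 0 (tapeOf v fun _ => ∅)

theorem step_config {q q' : SweepState κ Λ σ} (ha : q ≠ .accept) (hr : q ≠ .reject) {h : ℕ}
    {tape : ℕ → SweepCell Γ κ σ} {x : SweepCell Γ κ σ} {D : HeadMove}
    (hδ : X.delta q (tape h) = (q', x, D)) :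
    (X.toDTM incl i₀).step (X.config incl i₀ q h tape) =
      X.config incl i₀ q' (DTM.moveHead h D) (Function.update tape h x) := by
  refine (DTM.step_of_not_halted (X.toDTM incl i₀) (c := X.config incl i₀ q h tape)
    (not_or.2 ⟨ha, hr⟩)).trans ?_
  change X.config incl i₀ (X.delta q (tape h)).1 (DTM.moveHead h (X.delta q (tape h)).2.2)
    (Function.update tape h (X.delta q (tape h)).2.1) = _
  rw [hδ]

theorem sweep_forward (l : Λ) (v : κ → List Γ) (N : ℕ)
    (hN : ∀ i < N, ¬ X.StopsAt l (decide (i = 0)) (column v i) (X.reach v i)) :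
    (X.toDTM incl i₀).step^[N] (X.config incl i₀ (.fwd l {X.s₀}) 0 (tapeOf v fun _ => ∅)) =
      X.config incl i₀ (.fwd l (X.reach v N)) N
        (tapeOf v fun k => if k < N then X.reach v k else ∅) := by
  induction N with
  | zero => simp [reach]
  | succ N ih =>
    rw [Function.iterate_succ_apply', ih fun i hi => hN i (hi.trans (Nat.lt_succ_self _)),
      X.step_config incl i₀ (by simp) (by simp)
        (X.delta_fwd_of_not_stopsAt (hN N (Nat.lt_succ_self _)))]
    simp only [DTM.moveHead, tapeOf]
    congr 1
    ext1 k
    by_cases hk : k = N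
    · subst hk
      simp [tapeOf]
    · rw [Function.update_of_ne hk]
      have : k < N ↔ k < N + 1 := by omega
      simp only [tapeOf, this]

theorem sweep_turn (l : Λ) (v : κ → List Γ) (N : ℕ)
    (hN : X.StopsAt l (decide (N = 0)) (column v N) (X.reach v N)) :
    (X.toDTM incl i₀).step (X.config incl i₀ (.fwd l (X.reach v N)) N
        (tapeOf v fun k => if k < N then X.reach v k else ∅)) =
      X.config incl i₀ (X.turn l (X.reach v N)) (N - 1)
        (tapeOf v fun k => if k < N then X.reach v k else ∅) := by
  rw [X.step_config incl i₀ (by simp) (by simp) (X.delta_fwd_of_stopsAt hN)]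
  simp only [DTM.moveHead, tapeOf]
  congr 1
  rw [Function.update_eq_self_iff]
  simp [tapeOf]

theorem sweep_rewind (l : Λ) (v : κ → List Γ) (j : ℕ) (T : ℕ → Set σ) (hT : ∀ k > j, T k = ∅) :
    (X.toDTM incl i₀).step^[j + 1] (X.config incl i₀ (.rewind l) j (tapeOf v T)) =
      X.lineConfig incl i₀ l v := by
  have hupdate : ∀ j (T : ℕ → Set σ), Function.update (tapeOf v T) j (decide (j = 0), column v j, ∅) =
      tapeOf v (Function.update T j ∅) := by
    intro j T
    ext1 k
    by_cases hk : k = j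
    · subst hk
      simp [tapeOf]
    · simp [tapeOf, hk]
  induction j generalizing T with
  | zero =>
    rw [Function.iterate_one, X.step_config incl i₀ (by simp) (by simp) rfl]
    refine (congrArg (X.config incl i₀ (X.enter l) 0) (hupdate 0 T)).trans ?_
    have : Function.update T 0 ∅ = fun _ => ∅ := by
      ext1 k
      by_cases hk : k = 0
      · subst hk
        simp
      · rw [Function.update_of_ne hk, hT k (by omega)]
    rw [this]
    rfl
  | succ j ih =>
    rw [Function.iterate_succ_apply, X.step_config incl i₀ (by simp) (by simp) rfl,
      ← ih (Function.update T (j + 1) ∅)]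
    · exact congrArg (fun t => (X.toDTM incl i₀).step^[j + 1]
        (X.config incl i₀ (.rewind l) j t)) (hupdate (j + 1) T)
    · intro k hk
      by_cases hkj : k = j + 1
      · rw [hkj, Function.update_self]
      · rw [Function.update_of_ne hkj, hT k (by omega)]

open Classical in
/-- The tape during the backward sweep: the track `i` contains `d` after the cell `j`. -/
noncomputable def backTape (v : κ → List Γ) (i : κ) (d : ℕ → Option Γ) (j : ℕ) :
    ℕ → SweepCell Γ κ σ := fun k =>
  if k < j then (decide (k = 0), column v k, X.reach v k)
  else (decide (k = 0), Function.update (column v k) i (d k), ∅)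

open Classical in
theorem step_back (i : κ) (l : Λ) (v : κ → List Γ) (q : σ) (d : ℕ → Option Γ) (j : ℕ) :
    (X.toDTM incl i₀).step (X.config incl i₀ (.back i l q) j (X.backTape v i d (j + 1))) =
      X.config incl i₀
        (if j = 0 then X.enter l
          else .back i l (X.predecessor (X.reach v j) (column v j) q).1) (j - 1)
        (X.backTape v i
          (Function.update d j (X.predecessor (X.reach v j) (column v j) q).2) j) := by
  have : X.backTape v i d (j + 1) j = (decide (j = 0), column v j, X.reach v j) :=
    if_pos (Nat.lt_succ_self _)
  rw [X.step_config incl i₀ (by simp) (by simp)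
    ((congrArg (X.delta (.back i l q)) this).trans rfl)]
  simp only [DTM.moveHead]
  congr 1
  · simp
  · ext1 k
    by_cases hk : k = j
    · subst hk
      simp [backTape]
    · have : k < j ↔ k < j + 1 := by omega
      simp [backTape, hk, this]

/-- Each state of the run was reached from a state in the set stored one cell earlier, so
predecessors can be followed down to `X.s₀`. The letters chosen on the way spell a path ending in
`q`; those to the right of `j` are already fixed by `d`. -/
theorem sweep_back (i : κ) (l : Λ) (v : κ → List Γ) (j : ℕ) (q : σ) (d : ℕ → Option Γ)
    (hq : q ∈ X.reach v (j + 1)) :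
    ∃ d', (∀ k > j, d' k = d k) ∧ X.path v d' (j + 1) = q ∧
      (X.toDTM incl i₀).step^[j + 1]
        (X.config incl i₀ (.back i l q) j (X.backTape v i d (j + 1))) =
        X.config incl i₀ (X.enter l) 0 (X.backTape v i d' 0) := by
  classical
  obtain ⟨h1, h2⟩ := X.predecessor_spec hq
  induction j generalizing q d with
  | zero =>
    refine ⟨_, fun k hk => Function.update_of_ne (Nat.pos_iff_ne_zero.1 hk) _ _, ?_,
      X.step_back incl i₀ i l v q d 0⟩
    rw [path_succ, Function.update_self]
    -- The set stored at cell `0` is `{X.s₀}`, so the run chosen backwards starts correctly.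
    have : X.path v (Function.update d 0 (X.predecessor (X.reach v 0) (column v 0) q).2) 0 =
      (X.predecessor (X.reach v 0) (column v 0) q).1 := h1.symm
    rw [this, h2]
  | succ j ih =>
    rw [Function.iterate_succ_apply, step_back]
    set p := X.predecessor (X.reach v (j + 1)) (column v (j + 1)) q with hp
    obtain ⟨h3, h4⟩ := X.predecessor_spec h1
    obtain ⟨d', hd, hpath, hstep⟩ := ih p.1 (Function.update d (j + 1) p.2) h1 h3 h4
    refine ⟨d', fun k hk => ?_, ?_, hstep⟩
    · rw [hd k (by omega), Function.update_of_ne (by omega)]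
    · rw [path_succ, hpath, hd (j + 1) (by omega), Function.update_self, h2]

-- By `hC` acceptance does not depend on the guess, so the reachable set meets `X.acc l` exactly
-- when `C` holds.
open Classical in
theorem simulates_branch {l yes no : Λ} (hl : X.act l = .branch yes no) (v : κ → List Γ) {B : ℕ}
    (hB : ∀ j, (v j).length ≤ B) (hB1 : 1 ≤ B) (C : Prop)
    (hC : ∀ N d, (∀ j, (v j).length ≤ N) → (X.path v d N ∈ X.acc l ↔ C)) :
    ∃ m ≤ 2 * B + 1, (X.toDTM incl i₀).step^[m] (X.lineConfig incl i₀ l v) =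
      X.lineConfig incl i₀ (if C then yes else no) v := by
  obtain ⟨N, hN1, hNB, hturning, hlt⟩ := X.exists_turningPoint l v hB hB1 (n := 0) (by simp [hl])
  have henter : X.enter l = .fwd l {X.s₀} := by simp [enter, hl]
  have hlen := (column_eq_none_iff _ _).1 hturning.2.1
  have hC' : (X.reach v N ∩ X.acc l).Nonempty ↔ C := by
    constructor
    · rintro ⟨q, hq, hacc⟩
      obtain ⟨d, rfl⟩ := X.exists_path_of_mem_reach v hq
      exact (hC N d hlen).1 hacc
    · intro h
      exact ⟨_, X.path_mem_reach v (fun _ => none) N, (hC N _ hlen).2 h⟩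
  have hturn : X.turn l (X.reach v N) = .rewind (if C then yes else no) := by
    simp [turn, hl, hC']
  -- `N` steps forward, one to turn, `N` back.
  refine ⟨(N - 1 + 1) + (1 + N), by omega, ?_⟩
  rw [Function.iterate_add_apply _ (N - 1 + 1), Function.iterate_add_apply _ 1,
    Function.iterate_one]
  nth_rw 1 [lineConfig]
  rw [henter, X.sweep_forward incl i₀ l v N hlt, X.sweep_turn incl i₀ l v N hturning, hturn,
    sweep_rewind]
  intro k hk
  rw [if_neg (by omega)]

-- The correct guess `y` shows that acceptance is possible after `y.length` blank columns, hence
-- also after fewer than `Nat.card (Set σ)` of them. Whatever guess is accepted there must be `y` by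
-- `hy`; this also bounds the length of `y`.
open Classical in
theorem simulates_store {l l' : Λ} {i : κ} (hl : X.act l = .store i l') (v : κ → List Γ) {B : ℕ}
    (hB : ∀ j, (v j).length ≤ B) (hB1 : 1 ≤ B) (y : List Γ)
    (hy : ∀ N d, (∀ j, (v j).length ≤ N) →
      (X.path v d N ∈ X.acc l ↔ y.length ≤ N ∧ ∀ k < N, d k = y[k]?)) :
    y.length ≤ B + Nat.card (Set σ) ∧ ∃ m ≤ 2 * (B + Nat.card (Set σ)) + 1,
      (X.toDTM incl i₀).step^[m] (X.lineConfig incl i₀ l v) =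
        X.lineConfig incl i₀ l' (Function.update v i y) := by
  obtain ⟨n, hnK, hn⟩ := exists_iterate_mem_of_card (fun S => X.next S fun _ => none)
    (X.reach v B) {S | (S ∩ X.acc l).Nonempty} ⟨y.length, by
      rw [← X.reach_add v hB]
      refine ⟨_, X.path_mem_reach v (fun k => y[k]?) _, (hy _ _ fun j => ?_).2 ⟨?_, ?_⟩⟩
      · exact (hB j).trans (Nat.le_add_right _ _)
      · exact Nat.le_add_left _ _
      · exact fun _ _ => rfl⟩
  rw [← X.reach_add v hB] at hn
  obtain ⟨N, hN1, hNB, hturning, hlt⟩ := X.exists_turningPoint l v hB hB1 fun _ _ _ => hn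
  have henter : X.enter l = .fwd l {X.s₀} := by simp [enter, hl]
  have hlen := (column_eq_none_iff _ _).1 hturning.2.1
  obtain ⟨q, ⟨hq, hacc⟩, hturn⟩ : ∃ q, q ∈ X.reach v N ∩ X.acc l ∧
      X.turn l (X.reach v N) = .back i l' q :=
    ⟨_, Classical.epsilon_spec (p := fun q => q ∈ X.reach v N ∩ X.acc l) (hturning.2.2 i l' hl),
      by simp only [turn, hl]⟩
  obtain ⟨M, rfl⟩ : ∃ M, N = M + 1 := ⟨N - 1, by omega⟩
  obtain ⟨d, hd, rfl, hback⟩ := X.sweep_back incl i₀ i l' v M q (fun _ => none) hq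
  obtain ⟨hyN, hyd⟩ := (hy _ _ hlen).1 hacc
  refine ⟨by omega, (M + 1) + (1 + (M + 1)), by omega, ?_⟩
  rw [Function.iterate_add_apply _ (M + 1), Function.iterate_add_apply _ 1,
    Function.iterate_one]
  nth_rw 1 [lineConfig]
  rw [henter, X.sweep_forward incl i₀ l v (M + 1) hlt, X.sweep_turn incl i₀ l v (M + 1) hturning,
    hturn, Nat.add_sub_cancel]
  -- From the turning point on all columns are blank, so track `i` agrees there with the empty `d`.
  have h1 : (tapeOf v fun k => if k < M + 1 then X.reach v k else ∅) =
      X.backTape v i (fun _ => none) (M + 1) := by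
    ext1 k
    by_cases hk : k < M + 1
    · simp [tapeOf, backTape, hk]
    · have : column v k i = none := by
        simp only [column, List.getElem?_eq_none_iff]
        exact (hlen i).trans (not_lt.1 hk)
      simp [tapeOf, backTape, hk, this]
  have h2 : X.backTape v i d 0 = tapeOf (Function.update v i y) fun _ => ∅ := by
    ext1 k
    unfold tapeOf backTape
    rw [if_neg (Nat.not_lt_zero _)]
    have hdk : d k = y[k]? := by
      by_cases hk : k < M + 1
      · exact hyd k hk
      · rw [hd k (by omega), List.getElem?_eq_none (by omega)]
    have : Function.update (column v k) i (d k) = column (Function.update v i y) k := by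
      ext1 j
      by_cases hj : j = i
      · subst hj
        simp [column, hdk]
      · simp [column, hj]
    rw [this]
  rw [h1, hback, h2]
  rfl

open Classical in
theorem step_init (w : List A) : (X.toDTM incl i₀).step ((X.toDTM incl i₀).init w) =
    X.lineConfig incl i₀ X.l₀ (Function.update (fun _ => []) i₀ (w.map incl)) := by
  have hcol : ∀ k, (((X.toDTM incl i₀).init w).tape k : SweepCell Γ κ σ) =
      (false, column (Function.update (fun _ => []) i₀ (w.map incl)) k, ∅) := by
    intro k
    change (w.map (X.toDTM incl i₀).incl).getD k (X.toDTM incl i₀).blank = _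
    have : column (Function.update (fun _ => []) i₀ (w.map incl)) k =
        Function.update (fun _ => none) i₀ ((w.map incl)[k]?) := by
      ext1 j
      by_cases hj : j = i₀
      · subst hj
        simp [column]
      · simp [column, hj]
    rw [this, List.getD_eq_getElem?_getD, List.getElem?_map, List.getElem?_map]
    cases w[k]? with
    | none =>
      rw [Option.map_none, Option.map_none, Function.update_eq_self_iff.2 rfl]
      rfl
    | some a => rfl
  have hinit : (X.toDTM incl i₀).init w = X.config incl i₀ .start 0
      fun k => (false, column (Function.update (fun _ => []) i₀ (w.map incl)) k, ∅) :=
    congrArg (X.config incl i₀ .start 0) (funext hcol)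
  rw [hinit, X.step_config incl i₀ (by simp) (by simp) rfl]
  simp only [lineConfig, DTM.moveHead]
  congr 1
  ext1 k
  by_cases hk : k = 0
  · subst hk
    simp [tapeOf]
  · simp [tapeOf, hk]

end

end Sweeper

/-! ### Automatic register machines are simulated by Turing machines -/

theorem isRegular_univ {α : Type} : ∃ K : Language α, K.IsRegular ∧ ∀ l, l ∈ K :=
  ⟨_, ⟨Unit, inferInstance, ⟨fun _ _ => (), (), Set.univ⟩, rfl⟩, fun _ => trivial⟩

/-- The register changed by an instruction. -/
def ARMInstr.target {A F T : Type} {fa : F → ℕ} {ta : T → ℕ} {r : ℕ} :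
    ARMInstr A F T fa ta r → Option (Fin r)
  | .read i => some i
  | .assign i _ => some i
  | .copy i _ => some i
  | .apply i _ _ => some i
  | _ => none

namespace DARM

variable {A : Type} (M : DARM A)

/-- The tracks of the simulating Turing machine: one for the input, one for every register. -/
abbrev Track : Type := Option (Fin M.r)

/-- The line numbers; all those beyond the program are represented by its length. -/
abbrev Line : Type := Fin (M.prog.length + 1)

/-- The line number that represents `l`. -/
def clip (l : ℕ) : M.Line := ⟨min l M.prog.length, Nat.lt_succ_of_le (min_le_right _ _)⟩

theorem clip_val {l : ℕ} {I : ARMInstr A M.F M.T M.fa M.ta M.r} (h : M.prog[l]? = some I) :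
    (M.clip l : ℕ) = l :=
  min_eq_left (List.getElem?_eq_some_iff.1 h).1.le

/-- The strings on the tracks. -/
def tracks (w : List A) (regs : Fin M.r → List M.Γ) : M.Track → List M.Γ :=
  fun o => o.elim (w.map M.incl) regs

theorem update_tracks (w : List A) (regs : Fin M.r → List M.Γ) (i : Fin M.r) (y : List M.Γ)
    [DecidableEq M.Track] : Function.update (M.tracks w regs) (some i) y =
      M.tracks w (Function.update regs i y) := by
  ext1 o
  cases o with
  | none => rw [Function.update_of_ne (by simp)]; rfl
  | some j =>
    by_cases h : j = i
    · subst h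
      simp [tracks]
    · simp [tracks, h]

/-- The string that an instruction assigns to a register, if it is defined. -/
def result : ARMInstr A M.F M.T M.fa M.ta M.r → (M.Track → List M.Γ) → Option (List M.Γ)
  | .read _, v => some (v none)
  | .assign _ u, _ => some (u.map M.incl)
  | .copy _ j, v => some (v (some j))
  | .apply _ f args, v => M.fn f fun j => v (some (args j))
  | _, _ => none

/-- The condition of a jump. -/
def condition : ARMInstr A M.F M.T M.fa M.ta M.r → (M.Track → List M.Γ) → Prop
  | .ifGoto p args _, v => (fun j => v (some (args j))) ∈ M.test p
  | _, _ => True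

/-- What the simulating Turing machine does for an instruction, the next line being `l`. -/
def instrAction (l : ℕ) : ARMInstr A M.F M.T M.fa M.ta M.r → SweepAction M.Track M.Line
  | .read i => .store (some i) (M.clip l)
  -- Output does not affect acceptance: writing is a branch with equal targets.
  | .write _ => .branch (M.clip l) (M.clip l)
  | .assign i _ => .store (some i) (M.clip l)
  | .copy i _ => .store (some i) (M.clip l)
  | .apply i _ _ => .store (some i) (M.clip l)
  | .goto l' => .branch (M.clip l') (M.clip l')
  | .ifGoto _ _ l' => .branch (M.clip l') (M.clip l)
  | .halt => .stuck
  | .haltAccept => .accept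
  | .haltReject => .reject

/-- What the simulating Turing machine does at a line. -/
def action (l : ℕ) : SweepAction M.Track M.Line :=
  M.prog[l]?.elim .stuck (M.instrAction (l + 1))

/-- `P v N d` says, for all tracks `v` of length at most `N`, that `d` is the string assigned by
the instruction `I`, or that the condition of `I` is true if no string is assigned. -/
def InstrSpec (I : ARMInstr A M.F M.T M.fa M.ta M.r)
    (P : (M.Track → List M.Γ) → ℕ → (ℕ → Option M.Γ) → Prop) : Prop :=
  ∀ v N d, (∀ j, (v j).length ≤ N) →
    (P v N d ↔ if I.target = none then M.condition I v else
      ∃ y, M.result I v = some y ∧ y.length ≤ N ∧ ∀ i < N, d i = y[i]?)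

/-- Reading and copying are the identity on one track, and assigning is a nullary constant function.
-/
theorem exists_language_instr (I : ARMInstr A M.F M.T M.fa M.ta M.r) :
    ∃ K : Language ((M.Track → Option M.Γ) × Option M.Γ), K.IsRegular ∧
      M.InstrSpec I fun v N d => (List.range N).map (fun i => (column v i, d i)) ∈ K := by
  have := M.finΓ
  cases I with
  | read i => exact exists_language_fn isAutomaticFn_id fun _ => none
  | assign i u => exact exists_language_fn (isAutomaticFn_const (u.map M.incl)) Fin.elim0
  | copy i j => exact exists_language_fn isAutomaticFn_id fun _ => some j
  | apply i f args => exact exists_language_fn (M.fn_automatic f) fun j => some (args j)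
  | ifGoto p args l => exact exists_language_rel (M.test_automatic p) fun j => some (args j)
  | _ =>
    obtain ⟨K, hK, hmem⟩ := isRegular_univ (α := (M.Track → Option M.Γ) × Option M.Γ)
    exact ⟨K, hK, fun v N d _ => iff_of_true (hmem _) trivial⟩

theorem exists_sweeper : ∃ (σ : Type) (_ : Finite σ) (X : Sweeper M.Γ M.Track M.Line σ),
    (∀ l, X.act l = M.action l) ∧ X.l₀ = M.clip 0 ∧
      ∀ l I, M.prog[l]? = some I →
        M.InstrSpec I fun v N d => X.path v d N ∈ X.acc (M.clip l) := by
  choose K hK hspec using M.exists_language_instr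
  obtain ⟨K₀, hK₀, -⟩ := isRegular_univ (α := (M.Track → Option M.Γ) × Option M.Γ)
  obtain ⟨σ, hσ, stp, s₀, acc, hacc⟩ := exists_common_automaton
    (fun l : M.Line => (M.prog[(l : ℕ)]?).elim K₀ K) fun l => by
      cases M.prog[(l : ℕ)]? with
      | none => exact hK₀
      | some I => exact hK I
  refine ⟨σ, hσ, ⟨stp, s₀, acc, fun l => M.action l, M.clip 0⟩, fun _ => rfl, rfl, ?_⟩
  intro l I hl v N d hN
  rw [← hspec I v N d hN]
  refine (hacc (M.clip l) _).symm.trans ?_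
  rw [M.clip_val hl, hl]
  rfl

section

variable {M} {σ : Type} (X : Sweeper M.Γ M.Track M.Line σ)

/-- The state of the Turing machine that corresponds to a control status. -/
def statusState : ARMStatus → SweepState M.Track M.Line σ
  | .line l => X.enter (M.clip l)
  | .halted => .stuck
  | .accepted => .accept
  | .rejected => .reject

/-- Entering a halting line already puts the Turing machine into the halting state, so these
instructions cost no step. -/
theorem enter_clip (hact : ∀ l, X.act l = M.action l) {l : ℕ}
    {I : ARMInstr A M.F M.T M.fa M.ta M.r} (hl : M.prog[l]? = some I) {s : ARMStatus}
    (h : (M.action l = .accept ∧ s = .accepted) ∨ (M.action l = .reject ∧ s = .rejected) ∨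
      (M.action l = .stuck ∧ s = .halted)) : statusState X s = statusState X (.line l) := by
  simp only [statusState, Sweeper.enter, hact, M.clip_val hl]
  rcases h with ⟨h, rfl⟩ | ⟨h, rfl⟩ | ⟨h, rfl⟩ <;> rw [h]

variable [Finite M.Γ] [Finite σ]

/-- The configuration of the Turing machine that corresponds to a configuration of `M`. -/
def toTMConfig (w : List A) (c : M.Config) : (X.toDTM M.incl none).Config :=
  X.config M.incl none (statusState X c.status) 0
    (Sweeper.tapeOf (M.tracks w c.regs) fun _ => ∅)

/-- A step of `M` that leads from `c` to `c'` can be simulated, if the strings on the tracks have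
at most the length `B` before that step. -/
def Simulates (w : List A) (B : ℕ) (c c' : M.Config) : Prop :=
  (∀ j, (M.tracks w c'.regs j).length ≤ B + Nat.card (Set σ)) ∧
    ∃ m ≤ 2 * (B + Nat.card (Set σ)) + 1,
      (X.toDTM M.incl none).step^[m] (toTMConfig X w c) = toTMConfig X w c'

theorem simulates_of_eq {w : List A} {B : ℕ} {c c' : M.Config}
    (hB : ∀ j, (M.tracks w c.regs j).length ≤ B) (hregs : c'.regs = c.regs)
    (hstatus : statusState X c'.status = statusState X c.status) : Simulates X w B c c' := by
  refine ⟨fun j => ?_, 0, Nat.zero_le _, ?_⟩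
  · rw [hregs]
    exact (hB j).trans (Nat.le_add_right _ _)
  · simp [toTMConfig, hregs, hstatus]

theorem simulates_store (hact : ∀ l, X.act l = M.action l) {l : ℕ}
    {I : ARMInstr A M.F M.T M.fa M.ta M.r} (hl : M.prog[l]? = some I)
    (hspec : M.InstrSpec I fun v N d => X.path v d N ∈ X.acc (M.clip l))
    {w : List A} {B : ℕ} (hB1 : 1 ≤ B) {regs : Fin M.r → List M.Γ}
    (hB : ∀ j, (M.tracks w regs j).length ≤ B) {i : Fin M.r} {l' : ℕ} {y : List M.Γ}
    (hstore : M.action l = .store (some i) (M.clip l')) (htarget : I.target = some i)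
    (hy : M.result I (M.tracks w regs) = some y) (out : List (List M.Γ)) :
    Simulates X w B ⟨.line l, regs, out⟩ ⟨.line l', Function.update regs i y, out⟩ := by
  classical
  obtain ⟨hlen, m, hm, hsim⟩ := X.simulates_store M.incl none (l := M.clip l) (i := some i)
    (l' := M.clip l') (by rw [hact, M.clip_val hl, hstore]) (M.tracks w regs) hB hB1 y
    fun N d hN => by
      refine (hspec _ N d hN).trans ?_
      rw [htarget, hy]
      simp
  -- The update in `Sweeper.simulates_store` uses classical decidability of equality.
  have hup := @update_tracks A M w regs i y fun a b => Classical.propDecidable (a = b)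
  refine ⟨fun j => ?_, m, hm, ?_⟩
  · change (M.tracks w (Function.update regs i y) j).length ≤ _
    rw [← M.update_tracks]
    by_cases hj : j = some i
    · rw [hj, Function.update_self]
      exact hlen
    · rw [Function.update_of_ne hj]
      exact (hB j).trans (Nat.le_add_right _ _)
  · refine hsim.trans ?_
    rw [hup]
    rfl

theorem simulates_branch (hact : ∀ l, X.act l = M.action l) {l : ℕ}
    {I : ARMInstr A M.F M.T M.fa M.ta M.r} (hl : M.prog[l]? = some I)
    (hspec : M.InstrSpec I fun v N d => X.path v d N ∈ X.acc (M.clip l))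
    {w : List A} {B : ℕ} (hB1 : 1 ≤ B) {regs : Fin M.r → List M.Γ}
    (hB : ∀ j, (M.tracks w regs j).length ≤ B) {yes no : M.Line} {l' : ℕ}
    (hbranch : M.action l = .branch yes no) (htarget : I.target = none)
    (hyes : M.condition I (M.tracks w regs) → M.clip l' = yes)
    (hno : ¬ M.condition I (M.tracks w regs) → M.clip l' = no) (out out' : List (List M.Γ)) :
    Simulates X w B ⟨.line l, regs, out⟩ ⟨.line l', regs, out'⟩ := by
  classical
  obtain ⟨m, hm, hsim⟩ := X.simulates_branch M.incl none (l := M.clip l) (yes := yes) (no := no)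
    (by rw [hact, M.clip_val hl, hbranch]) (M.tracks w regs) hB hB1
    (M.condition I (M.tracks w regs)) fun N d hN => by
      exact (hspec _ N d hN).trans (by rw [if_pos htarget])
  refine ⟨fun j => (hB j).trans (Nat.le_add_right _ _), m, by omega, hsim.trans ?_⟩
  have : (if M.condition I (M.tracks w regs) then yes else no) = M.clip l' := by
    split_ifs with h
    · exact (hyes h).symm
    · exact (hno h).symm
  rw [this]
  rfl

theorem simulates_step (hact : ∀ l, X.act l = M.action l)
    (hspec : ∀ l I, M.prog[l]? = some I →
      M.InstrSpec I fun v N d => X.path v d N ∈ X.acc (M.clip l))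
    {w : List A} {B : ℕ} (hB1 : 1 ≤ B) {c : M.Config}
    (hB : ∀ j, (M.tracks w c.regs j).length ≤ B) : Simulates X w B c (M.step w c) := by
  obtain ⟨s, regs, out⟩ := c
  -- Unchanged configurations need no Turing step; this covers halted machines, missing lines and
  -- functions applied outside their domain.
  by_cases hstep : M.step w ⟨s, regs, out⟩ = ⟨s, regs, out⟩
  · rw [hstep]
    exact simulates_of_eq X hB rfl rfl
  cases s with
  | line l =>
    cases hl : M.prog[l]? with
    | none => exact absurd (by simp only [step, hl]) hstep
    | some I =>
      have hexec : M.step w ⟨.line l, regs, out⟩ = M.exec w ⟨.line l, regs, out⟩ l I := by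
        simp only [step, hl]
      rw [hexec] at hstep ⊢
      have hI := hspec l I hl
      have ha : M.action l = M.instrAction (l + 1) I := by rw [action, hl, Option.elim_some]
      cases I with
      | read i => exact simulates_store X hact hl hI hB1 hB ha rfl rfl out
      | write i =>
        exact simulates_branch X hact hl hI hB1 hB ha rfl (fun _ => rfl)
          (fun _ => rfl) _ _
      | assign i u => exact simulates_store X hact hl hI hB1 hB ha rfl rfl out
      | copy i j => exact simulates_store X hact hl hI hB1 hB ha rfl rfl out
      | apply i f args =>
        cases hy : M.fn f fun j => regs (args j) with
        | none => exact absurd (by simp only [exec, hy]) hstep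
        | some y =>
          have : M.exec w ⟨.line l, regs, out⟩ l (.apply i f args) =
              ⟨.line (l + 1), Function.update regs i y, out⟩ := by
            simp only [exec, hy]
          rw [this]
          exact simulates_store X hact hl hI hB1 hB ha rfl hy out
      | goto l' =>
        exact simulates_branch X hact hl hI hB1 hB ha rfl (fun _ => rfl)
          (fun _ => rfl) _ _
      | ifGoto p args l' =>
        by_cases hp : (fun j => regs (args j)) ∈ M.test p
        · have : M.exec w ⟨.line l, regs, out⟩ l (.ifGoto p args l') = ⟨.line l', regs, out⟩ :=
            if_pos hp
          rw [this]
          exact simulates_branch X hact hl hI hB1 hB ha rfl (fun _ => rfl)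
            (fun h => absurd hp h) _ _
        · have : M.exec w ⟨.line l, regs, out⟩ l (.ifGoto p args l') =
              ⟨.line (l + 1), regs, out⟩ := if_neg hp
          rw [this]
          exact simulates_branch X hact hl hI hB1 hB ha rfl
            (fun h => absurd h hp) (fun _ => rfl) _ _
      | halt =>
        exact simulates_of_eq X hB rfl
          (enter_clip X hact hl (.inr (.inr ⟨ha, rfl⟩)))
      | haltAccept =>
        exact simulates_of_eq X hB rfl (enter_clip X hact hl (.inl ⟨ha, rfl⟩))
      | haltReject =>
        exact simulates_of_eq X hB rfl
          (enter_clip X hact hl (.inr (.inl ⟨ha, rfl⟩)))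
  | halted => exact absurd rfl hstep
  | accepted => exact absurd rfl hstep
  | rejected => exact absurd rfl hstep

/-- During `m` steps the lengths never exceed `B + m * Nat.card (Set σ)`, so every step is one pair
of sweeps over at most that many cells. -/
theorem simulates_iterate (hact : ∀ l, X.act l = M.action l)
    (hspec : ∀ l I, M.prog[l]? = some I →
      M.InstrSpec I fun v N d => X.path v d N ∈ X.acc (M.clip l))
    (w : List A) (m B : ℕ) (hB1 : 1 ≤ B) (c : M.Config)
    (hB : ∀ j, (M.tracks w c.regs j).length ≤ B) :
    ∃ m' ≤ m * (2 * (B + m * Nat.card (Set σ)) + 1),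
      (X.toDTM M.incl none).step^[m'] (toTMConfig X w c) =
        toTMConfig X w ((M.step w)^[m] c) := by
  induction m generalizing B c with
  | zero => exact ⟨0, Nat.zero_le _, rfl⟩
  | succ m ih =>
    obtain ⟨hlen, m₁, hm₁, h₁⟩ := simulates_step X hact hspec hB1 hB
    obtain ⟨m₂, hm₂, h₂⟩ := ih (B + Nat.card (Set σ)) (hB1.trans (Nat.le_add_right _ _)) _ hlen
    refine ⟨m₂ + m₁, ?_, ?_⟩
    · generalize Nat.card (Set σ) = K at *
      have h3 : m * (2 * (B + K + m * K) + 1) = m * (2 * (B + (m + 1) * K) + 1) := by ring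
      have h4 : (m + 1) * (2 * (B + (m + 1) * K) + 1) =
          m * (2 * (B + (m + 1) * K) + 1) + (2 * (B + K) + 1) + 2 * (m * K) := by ring
      omega
    · rw [Function.iterate_add_apply, h₁, h₂, Function.iterate_succ_apply]

end

/-- The initial length bound is `n + 1`, as sweeps need a positive bound even for the empty input;
the final `+ 1` is the step that marks the leftmost cell. -/
theorem exists_dtm_decidesIn {L : Language A} {t : ℕ → ℕ} (h : M.RecognizesIn L t) :
    ∃ (D : DTM A) (K : ℕ), D.DecidesIn L fun n => t n * (2 * (n + 1 + t n * K) + 1) + 1 := by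
  have := M.finΓ
  obtain ⟨σ, hσ, X, hact, hl₀, hspec⟩ := M.exists_sweeper
  refine ⟨X.toDTM M.incl none, Nat.card (Set σ), fun w => ?_⟩
  have hinit : (X.toDTM M.incl none).step ((X.toDTM M.incl none).init w) =
      toTMConfig X w M.init := by
    classical
    rw [X.step_init M.incl none w, hl₀]
    unfold Sweeper.lineConfig toTMConfig
    congr 2
    ext1 o
    cases o with
    | none => exact dif_pos rfl
    | some j => exact dif_neg (by simp)
  have hrun : ∀ m ≤ t w.length, ∃ m' ≤ t w.length *
      (2 * (w.length + 1 + t w.length * Nat.card (Set σ)) + 1) + 1,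
      ((X.toDTM M.incl none).run w m').state = statusState X (M.run w m).status := by
    intro m hm
    obtain ⟨m', hm', h'⟩ := simulates_iterate X hact hspec w m (w.length + 1)
      (Nat.le_add_left _ _) M.init (by
        rintro (_ | j)
        · simp [tracks]
        · simp [tracks, init])
    refine ⟨m' + 1, Nat.succ_le_succ (hm'.trans (by gcongr)), ?_⟩
    rw [DTM.run, Function.iterate_succ_apply, hinit, h']
    rfl
  constructor
  · intro hw
    obtain ⟨m, hm, hacc⟩ := (h w).1 hw
    obtain ⟨m', hm', h'⟩ := hrun m hm
    exact ⟨m', hm', by rw [h', hacc]; rfl⟩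
  · intro hw
    obtain ⟨m, hm, hrej⟩ := (h w).2 hw
    obtain ⟨m', hm', h'⟩ := hrun m hm
    exact ⟨m', hm', by rw [h', hrej]; rfl⟩

end DARM

/-! ### Growth of the simulation time and the second inclusion -/

theorem natCast_pow_isBigO_pow {a b : ℕ} (hab : a ≤ b) :
    (fun n : ℕ => (n : ℝ) ^ a) =O[atTop] fun n : ℕ => (n : ℝ) ^ b := by
  refine IsBigO.of_bound 1 ?_
  filter_upwards [eventually_ge_atTop 1] with n hn
  rw [one_mul, Real.norm_of_nonneg (by positivity), Real.norm_of_nonneg (by positivity)]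
  exact pow_le_pow_right₀ (by exact_mod_cast hn) hab

theorem DALPoly_subset_PTIME (A : Type) : DALPoly A ⊆ PTIME A := by
  intro L hL
  obtain ⟨k, M, t, ht, hM⟩ := Set.mem_iUnion.1 hL
  obtain ⟨D, K, hD⟩ := M.exists_dtm_decidesIn hM
  -- The time bound expands into `t * t`, `t * n`, `t` and constants, of degrees `2 * k`, `k + 1`,
  -- `k` and `0`; the exponent `2 * k + 1` covers them all.
  refine Set.mem_iUnion.2 ⟨2 * k + 1, D, _, ?_, hD⟩
  have h1 : (fun n => (t n : ℝ)) =O[atTop] fun n : ℕ => (n : ℝ) ^ (2 * k + 1) :=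
    ht.trans (natCast_pow_isBigO_pow (by omega))
  have h2 : (fun n => (t n : ℝ) * (n : ℝ)) =O[atTop] fun n : ℕ => (n : ℝ) ^ (2 * k + 1) := by
    refine IsBigO.trans ?_ (natCast_pow_isBigO_pow (show k + 1 ≤ 2 * k + 1 by omega))
    simpa only [pow_succ] using ht.mul (isBigO_refl (fun n : ℕ => (n : ℝ)) atTop)
  have h3 : (fun n => (t n : ℝ) * (t n : ℝ)) =O[atTop] fun n : ℕ => (n : ℝ) ^ (2 * k + 1) := by
    refine IsBigO.trans ?_ (natCast_pow_isBigO_pow (show k + k ≤ 2 * k + 1 by omega))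
    simpa only [pow_add] using ht.mul ht
  have h := (((h2.const_mul_left 2).add (h1.const_mul_left 3)).add
    (h3.const_mul_left (2 * K))).add (one_isBigO_natCast_pow (2 * k + 1))
  refine h.congr_left fun n => ?_
  push_cast
  ring

/-- For every finite alphabet, the languages recognized by deterministic automatic register
machines in polynomially many steps are exactly the languages in `P`. -/
theorem mainTheorem2 (A : Type) [Finite A] : DALPoly A = PTIME A :=
  (DALPoly_subset_PTIME A).antisymm (PTIME_subset_DALPoly A)
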